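/- Let $H$ be an infinite-dimensional separable complex Hilbert space. For $X\in B(H)$ and $t\ge 0$ let $\mu(t,X)=\inf\{\|XP\| : P \text{ a projection},\ \mathrm{Tr}(1-P)\le t\}$ be its generalised singular value function; it equals the singular value $\mu(n,X)$ for $t\in[n,n+1)$. For a decreasing function $g:(0,\infty)\to(0,\infty)$ that vanishes at infinity and satisfies $\sup_{t>0} g(t)/g(2t)<\infty$, let $$\mathcal L_g(H)=\Big\{X\in B(H):\ \sup_{t>0}\frac{\mu(t,X)}{g(t)}<\infty\Big\}.$$ A linear functional $\varphi$ on $\mathcal L_g(H)$ is symmetric if $\varphi(X)=\varphi(Y)$ whenever $X,Y\ge0$ and $\mu(\cdot,X)=\mu(\cdot,Y)$. An extended limit is a positive bounded linear functional $\omega$ on $\ell_\infty=\ell_\infty(\mathbb Z_+)$ with $\omega(x)=\lim_n x_n$ for every convergent $x$. If $g$ is bounded and not integrable with $g(t)/g(2t)\to2$ as $t\to\infty$, a Dixmier trace on $\mathcal L_g(H)$ is a symmetric functional $\varphi$ for which there is an extended limit $\omega$ with $$\varphi(X)=\log 2\cdot\omega\Big(n\mapsto \frac{\sum_{k=0}^n\mu(k,X)}{G(n)}\Big)\quad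 (0\le X\in\mathcal L_g(H)),\qquad G(n)=\int_0^n g(s)\,ds$$ (the entry at $n=0$ is irrelevant and is set to $0$). Fix an orthonormal sequence $(e_k)_{k\ge0}$ in $H$. For $x\in\ell_\infty$ let $\mathcal D_g x\in\mathcal L_g(H)$ be the diagonal operator with $\mathcal D_gx\,e_k=x_n g(2^n)e_k$ for $2^n\le k<2^{n+1}$, $n\ge0$, which vanishes on $e_0$ and on the orthogonal complement of $\{e_k\}$. For $X\in\mathcal L_f(H)$ let $$\Phi_f(X)=\Big\{\frac1{2^nf(2^n)}\int_{2^n}^{2^{n+1}}\mu(s,X)\,ds\Big\}_{n\ge0}\in\ell_\infty .$$ For a linear functional $\varphi$ on $\mathcal L_g(H)$ let $i_{g,f}(\varphi)$ be the linear functional on $\mathcal L_f(H)$ given by $i_{g,f}(\varphi)(X)=\varphi(\mathcal D_g\Phi_f(X))$ for $0\le X\in\mathcal L_f(H)$, provided such a linear functional exists and is unique. Theorem. Let $$f(t)=\begin{cases}1,&0<t<1,\\ 1/t,&t\ge1,\end{cases}\qquad g(t)=\begin{cases}1/2,&0<t<2,\\ \dfrac1{t\log_2t},&t\ge2.\end{cases}$$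 Then $\mathcal L_f(H)=\mathcal L_{1,\infty}(H)=\{X\in B(H):\sup_{n\ge0}(n+1)\mu(n,X)<\infty\}$. For every Dixmier trace $\varphi$ on $\mathcal L_g(H)$ the functional $i_{g,f}(\varphi)$ is well defined and is a Dixmier trace on $\mathcal L_f(H)$, but $i_{g,f}$ does not map the set of Dixmier traces on $\mathcal L_g(H)$ onto the set of Dixmier traces on $\mathcal L_f(H)$. Moreover, for $y=\sum_{n\ge1}\chi_{[2^{2n},2^{2n+1})}\in\ell_\infty$, $$\{i_{g,f}(\varphi)(\mathcal D_fy):\varphi \text{ a Dixmier trace on }\mathcal L_g(H)\}=\{\tfrac12\},\qquad \{\psi(\mathcal D_fy):\psi \text{ a Dixmier trace on }\mathcal L_f(H)\}=[\tfrac13,\tfrac23].$$ -/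

import Mathlib

open Filter Topology Set
open scoped ENNReal ComplexOrder

noncomputable section

/-! ### Bounded sequences and extended limits -/

/-- The space `ℓ_∞` of bounded complex sequences indexed by `0, 1, 2, …`. -/
abbrev Linf : Type := lp (fun _ : ℕ => ℂ) ∞

/-- An extended limit: a positive bounded linear functional on `ℓ_∞` which agrees with the ordinary
limit on every convergent sequence. -/
structure IsExtendedLimit (ω : Linf →L[ℂ] ℂ) : Prop where
  nonneg : ∀ x : Linf, (∀ n, 0 ≤ x n) → 0 ≤ ω x
  eq_lim : ∀ (x : Linf) (a : ℂ), Tendsto (fun n => x n) atTop (𝓝 a) → ω x = a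

/-! ### Singular values and the ideals `L_g(H)` -/

section Ideal

variable {H : Type*} [NormedAddCommGroup H] [InnerProductSpace ℂ H] [CompleteSpace H]

/-- The generalised singular value function `μ(t, X)` for `B(H)` with its standard trace: the
infimum of `‖X P‖` over the projections `P` with `Tr (1 - P) ≤ t`. Such a `P` is the orthogonal
projection onto `Kᗮ`, where `K` is the range of `1 - P`, and `Tr (1 - P) = dim K`. -/
def mu (t : ℝ) (X : H →L[ℂ] H) : ℝ :=
  sInf {r : ℝ | ∃ K : Submodule ℂ H, FiniteDimensional ℂ K ∧ (Module.finrank ℂ K : ℝ) ≤ t ∧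
    r = ‖X ∘L Kᗮ.starProjection‖}

/-- A decreasing function `g : (0, ∞) → (0, ∞)` vanishing at infinity with
`sup_{t > 0} g(t) / g(2t) < ∞`. The values of `toFun` outside `(0, ∞)` play no role. -/
structure Weight where
  toFun : ℝ → ℝ
  pos : ∀ t, 0 < t → 0 < toFun t
  anti : AntitoneOn toFun (Ioi 0)
  tendsto_zero : Tendsto toFun atTop (𝓝 0)
  doubling : ∃ C : ℝ, ∀ t, 0 < t → toFun t / toFun (2 * t) ≤ C

instance : CoeFun Weight (fun _ => ℝ → ℝ) := ⟨Weight.toFun⟩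

theorem Weight.exists_half_le (g : Weight) :
    ∃ C : ℝ, 0 ≤ C ∧ ∀ t, 0 < t → g (t / 2) ≤ C * g t := by
  obtain ⟨C, hC⟩ := g.doubling
  have hC' : ∀ t, 0 < t → g (t / 2) ≤ C * g t := by
    intro t ht
    have h := hC (t / 2) (by positivity)
    rw [mul_div_cancel₀ t (two_ne_zero' ℝ), div_le_iff₀ (g.pos t ht)] at h
    exact h
  refine ⟨C, ?_, hC'⟩
  have h1 := hC 1 one_pos
  exact (div_pos (g.pos 1 one_pos) (g.pos (2 * 1) (by norm_num))).le.trans h1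

theorem mu_bddBelow (t : ℝ) (X : H →L[ℂ] H) :
    BddBelow {r : ℝ | ∃ K : Submodule ℂ H, FiniteDimensional ℂ K ∧
      (Module.finrank ℂ K : ℝ) ≤ t ∧ r = ‖X ∘L Kᗮ.starProjection‖} :=
  ⟨0, by rintro r ⟨K, -, -, rfl⟩; exact norm_nonneg _⟩

theorem mu_nonempty {t : ℝ} (ht : 0 ≤ t) (X : H →L[ℂ] H) :
    {r : ℝ | ∃ K : Submodule ℂ H, FiniteDimensional ℂ K ∧
      (Module.finrank ℂ K : ℝ) ≤ t ∧ r = ‖X ∘L Kᗮ.starProjection‖}.Nonempty :=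
  ⟨_, ⊥, inferInstance, by simpa using ht, rfl⟩

theorem mu_nonneg (t : ℝ) (X : H →L[ℂ] H) : 0 ≤ mu t X := by
  apply Real.sInf_nonneg
  rintro r ⟨K, -, -, rfl⟩
  exact norm_nonneg _

theorem mu_le {t : ℝ} (X : H →L[ℂ] H) (K : Submodule ℂ H) (hK : FiniteDimensional ℂ K)
    (hd : (Module.finrank ℂ K : ℝ) ≤ t) : mu t X ≤ ‖X ∘L Kᗮ.starProjection‖ :=
  csInf_le (mu_bddBelow t X) ⟨K, hK, hd, rfl⟩

theorem mu_anti {s t : ℝ} (hs : 0 ≤ s) (hst : s ≤ t) (X : H →L[ℂ] H) : mu t X ≤ mu s X := by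
  apply csInf_le_csInf (mu_bddBelow t X) (mu_nonempty hs X)
  rintro r ⟨K, h1, h2, rfl⟩
  exact ⟨K, h1, h2.trans hst, rfl⟩

theorem mu_zero (t : ℝ) : mu t (0 : H →L[ℂ] H) = 0 := by
  apply le_antisymm _ (mu_nonneg t 0)
  apply Real.sInf_nonpos
  rintro r ⟨K, -, -, rfl⟩
  simp

theorem mu_smul_le {t : ℝ} (ht : 0 ≤ t) (c : ℂ) (X : H →L[ℂ] H) :
    mu t (c • X) ≤ ‖c‖ * mu t X := by
  unfold mu
  rw [← smul_eq_mul, ← Real.sInf_smul_of_nonneg (norm_nonneg c)]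
  apply csInf_le_csInf (mu_bddBelow t (c • X)) ((mu_nonempty ht X).smul_set)
  rintro r ⟨_, ⟨K, h1, h2, rfl⟩, rfl⟩
  exact ⟨K, h1, h2, by simp [ContinuousLinearMap.smul_comp, norm_smul]⟩

theorem mu_add_le {t : ℝ} (ht : 0 ≤ t) (X Y : H →L[ℂ] H) :
    mu t (X + Y) ≤ mu (t / 2) X + mu (t / 2) Y := by
  have ht' : 0 ≤ t / 2 := by positivity
  have key : ∀ (Z : H →L[ℂ] H) (K L : Submodule ℂ H), FiniteDimensional ℂ K →
      FiniteDimensional ℂ L → K ≤ L →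
      ‖Z ∘L Lᗮ.starProjection‖ ≤ ‖Z ∘L Kᗮ.starProjection‖ := by
    intro Z K L _ _ hKL
    have h : Lᗮ.starProjection = Kᗮ.starProjection ∘L Lᗮ.starProjection := by
      ext v
      have hv : Lᗮ.starProjection v ∈ Kᗮ :=
        Submodule.orthogonal_le hKL (Submodule.starProjection_apply_mem _ _)
      exact (Submodule.starProjection_eq_self_iff.mpr hv).symm
    rw [h, ← ContinuousLinearMap.comp_assoc]
    refine (ContinuousLinearMap.opNorm_comp_le _ _).trans ?_
    exact mul_le_of_le_one_right (norm_nonneg _) (Submodule.starProjection_norm_le _)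
  rw [← sub_le_iff_le_add]
  apply le_csInf (mu_nonempty ht' X)
  rintro _ ⟨K, hK, hKd, rfl⟩
  rw [sub_le_iff_le_add, ← sub_le_iff_le_add']
  apply le_csInf (mu_nonempty ht' Y)
  rintro _ ⟨L, hL, hLd, rfl⟩
  rw [sub_le_iff_le_add']
  have hd : (Module.finrank ℂ (K ⊔ L : Submodule ℂ H) : ℝ) ≤ t := by
    have h := Submodule.finrank_add_le_finrank_add_finrank K L
    have h' : (Module.finrank ℂ (K ⊔ L : Submodule ℂ H) : ℝ)
        ≤ Module.finrank ℂ K + Module.finrank ℂ L := by exact_mod_cast h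
    linarith
  refine (mu_le (X + Y) (K ⊔ L) inferInstance hd).trans ?_
  rw [ContinuousLinearMap.add_comp]
  exact (norm_add_le _ _).trans (add_le_add (key X K _ hK inferInstance le_sup_left)
    (key Y L _ hL inferInstance le_sup_right))

variable (H) in
/-- The space `L_g(H)` of all `X ∈ B(H)` with `sup_{t > 0} μ(t, X) / g(t) < ∞`. -/
def LIdeal (g : Weight) : Submodule ℂ (H →L[ℂ] H) where
  carrier := {X | ∃ C : ℝ, ∀ t, 0 < t → mu t X / g t ≤ C}
  zero_mem' := ⟨0, fun t _ => by simp [mu_zero]⟩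
  add_mem' := by
    rintro X Y ⟨A, hA⟩ ⟨B, hB⟩
    obtain ⟨C, hC0, hC⟩ := g.exists_half_le
    refine ⟨|A + B| * C, fun t ht => ?_⟩
    have ht2 : 0 < t / 2 := by positivity
    have h1 := (div_le_iff₀ (g.pos _ ht2)).mp (hA (t / 2) ht2)
    have h2 := (div_le_iff₀ (g.pos _ ht2)).mp (hB (t / 2) ht2)
    rw [div_le_iff₀ (g.pos t ht)]
    calc mu t (X + Y) ≤ mu (t / 2) X + mu (t / 2) Y := mu_add_le ht.le X Y
      _ ≤ (A + B) * g (t / 2) := by linarith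
      _ ≤ |A + B| * g (t / 2) :=
        mul_le_mul_of_nonneg_right (le_abs_self _) (g.pos _ ht2).le
      _ ≤ |A + B| * (C * g t) := mul_le_mul_of_nonneg_left (hC t ht) (abs_nonneg _)
      _ = |A + B| * C * g t := by ring
  smul_mem' := by
    rintro c X ⟨A, hA⟩
    refine ⟨‖c‖ * A, fun t ht => ?_⟩
    refine le_trans ?_ (mul_le_mul_of_nonneg_left (hA t ht) (norm_nonneg c))
    rw [← mul_div_assoc]
    exact div_le_div_of_nonneg_right (mu_smul_le ht.le c X) (g.pos t ht).le

/-! ### Symmetric functionals and Dixmier traces -/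

/-- A linear functional on `L_g(H)` is symmetric if it takes equal values on positive operators
with the same singular value function. -/
def IsSymmetricFunctional {g : Weight} (φ : LIdeal H g →ₗ[ℂ] ℂ) : Prop :=
  ∀ X Y : LIdeal H g, (X : H →L[ℂ] H).IsPositive → (Y : H →L[ℂ] H).IsPositive →
    (∀ t, 0 < t → mu t (X : H →L[ℂ] H) = mu t (Y : H →L[ℂ] H)) → φ X = φ Y

/-- Dixmier traces on `L_g(H)` (for `g` bounded, non-integrable, `g(t) / g(2t) → 2` at infinity):
symmetric functionals of the form
`φ(X) = log 2 · ω (n ↦ (∑_{k ≤ n} μ(k, X)) / G(n))` for `X ≥ 0`, where `G(n) = ∫_0^n g` and `ω` is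
an extended limit. The entry at `n = 0`, where `G(0) = 0`, is `0` by convention; extended limits do
not see it. The factor `log 2` is the one for which every Dixmier trace has value `1` on the
diagonal operator with entries `g(2^n)` for `2^n ≤ k < 2^(n+1)`. -/
def IsDixmierTrace {g : Weight} (φ : LIdeal H g →ₗ[ℂ] ℂ) : Prop :=
  IsSymmetricFunctional φ ∧ ∃ ω : Linf →L[ℂ] ℂ, IsExtendedLimit ω ∧
    ∀ X : LIdeal H g, (X : H →L[ℂ] H).IsPositive →
      ∃ hb : Memℓp (fun n : ℕ =>
          (((∑ k ∈ Finset.range (n + 1), mu k (X : H →L[ℂ] H)) / ∫ s in (0 : ℝ)..n, g s : ℝ) : ℂ)) ∞,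
        φ X = (Real.log 2 : ℂ) * ω ⟨_, hb⟩

/-! ### The map `Φ_f` -/

theorem PhiSeq_mem (f : Weight) (X : LIdeal H f) :
    Memℓp (fun n : ℕ => ((1 / (2 ^ n * f (2 ^ n)) *
      ∫ s in (2 ^ n : ℝ)..2 ^ (n + 1), mu s (X : H →L[ℂ] H) : ℝ) : ℂ)) ∞ := by
  obtain ⟨C, hC⟩ := X.2
  apply memℓp_infty
  refine ⟨C, ?_⟩
  rintro _ ⟨n, rfl⟩
  have hn : (0 : ℝ) < 2 ^ n := by positivity
  have hf := f.pos _ hn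
  have hint : ‖∫ s in (2 ^ n : ℝ)..2 ^ (n + 1), mu s (X : H →L[ℂ] H)‖ ≤
      mu (2 ^ n) (X : H →L[ℂ] H) * |(2 : ℝ) ^ (n + 1) - 2 ^ n| := by
    apply intervalIntegral.norm_integral_le_of_norm_le_const
    intro s hs
    rw [uIoc_of_le (pow_le_pow_right₀ one_le_two n.le_succ)] at hs
    rw [Real.norm_of_nonneg (mu_nonneg _ _)]
    exact mu_anti hn.le hs.1.le _
  have habs : |(2 : ℝ) ^ (n + 1) - 2 ^ n| = 2 ^ n := by
    rw [pow_succ, mul_two, add_sub_cancel_right, abs_of_pos hn]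
  rw [habs] at hint
  simp only [Complex.norm_real, norm_mul]
  rw [Real.norm_of_nonneg (by positivity : (0 : ℝ) ≤ 1 / (2 ^ n * f (2 ^ n)))]
  calc 1 / (2 ^ n * f (2 ^ n)) * ‖∫ s in (2 ^ n : ℝ)..2 ^ (n + 1), mu s (X : H →L[ℂ] H)‖
      ≤ 1 / (2 ^ n * f (2 ^ n)) * (mu (2 ^ n) (X : H →L[ℂ] H) * 2 ^ n) :=
        mul_le_mul_of_nonneg_left hint (by positivity)
    _ = mu (2 ^ n) (X : H →L[ℂ] H) / f (2 ^ n) := by field_simp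
    _ ≤ C := hC _ hn

/-- `Φ_f(X) = { (1 / (2^n f(2^n))) ∫_{2^n}^{2^(n+1)} μ(s, X) ds }_{n ≥ 0}`. -/
def Phi (f : Weight) (X : LIdeal H f) : Linf :=
  ⟨fun n : ℕ => ((1 / (2 ^ n * f (2 ^ n)) *
    ∫ s in (2 ^ n : ℝ)..2 ^ (n + 1), mu s (X : H →L[ℂ] H) : ℝ) : ℂ), PhiSeq_mem f X⟩

/-! ### Diagonal operators and the map `𝒟_g` -/

theorem diag_sum {e : ℕ → H} (he : Orthonormal ℂ e) {a : ℕ → ℂ} {M : ℝ}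
    (ha : ∀ k, ‖a k‖ ≤ M) (v : H) :
    Summable (fun k => (a k * inner ℂ (e k) v) • e k) ∧
      ‖∑' k, (a k * inner ℂ (e k) v) • e k‖ ≤ M * ‖v‖ := by
  have hM : 0 ≤ M := (norm_nonneg _).trans (ha 0)
  have hbound : ∀ k, ‖a k * inner ℂ (e k) v‖ ^ 2 ≤ M ^ 2 * ‖inner ℂ (e k) v‖ ^ 2 := by
    intro k
    rw [norm_mul, mul_pow]
    exact mul_le_mul_of_nonneg_right (pow_le_pow_left₀ (norm_nonneg _) (ha k) 2) (sq_nonneg _)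
  have hs : Summable (fun k => ‖a k * inner ℂ (e k) v‖ ^ 2) :=
    Summable.of_nonneg_of_le (fun _ => sq_nonneg _) hbound
      ((he.inner_products_summable v).mul_left (M ^ 2))
  have hsum : Summable (fun k => (a k * inner ℂ (e k) v) • e k) :=
    (he.orthogonalFamily.summable_iff_norm_sq_summable (fun k => a k * inner ℂ (e k) v)).mpr hs
  refine ⟨hsum, ?_⟩
  refine le_of_tendsto hsum.hasSum.norm (Eventually.of_forall fun s => ?_)
  refine abs_le_of_sq_le_sq' ?_ (by positivity) |>.2
  have hn := he.orthogonalFamily.norm_sum (fun k => a k * inner ℂ (e k) v) s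
  simp only [LinearIsometry.toSpanSingleton_apply] at hn
  rw [hn, mul_pow]
  calc ∑ k ∈ s, ‖a k * inner ℂ (e k) v‖ ^ 2 ≤ ∑ k ∈ s, M ^ 2 * ‖inner ℂ (e k) v‖ ^ 2 :=
        Finset.sum_le_sum fun k _ => hbound k
    _ = M ^ 2 * ∑ k ∈ s, ‖inner ℂ (e k) v‖ ^ 2 := by rw [Finset.mul_sum]
    _ ≤ M ^ 2 * ‖v‖ ^ 2 := mul_le_mul_of_nonneg_left (he.sum_inner_products_le v) (sq_nonneg M)

/-- The diagonal operator `v ↦ ∑_k a_k ⟨v, e_k⟩ e_k` of a bounded sequence `a`, for an orthonormal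
sequence `e` (it vanishes on the orthogonal complement of `e`). -/
def diagOp {e : ℕ → H} (he : Orthonormal ℂ e) (a : Linf) : H →L[ℂ] H :=
  LinearMap.mkContinuous
    { toFun := fun v => ∑' k, (a k * inner ℂ (e k) v) • e k
      map_add' := fun v w => by
        rw [← ((diag_sum he (lp.norm_apply_le_norm ENNReal.top_ne_zero a) v).1).tsum_add
          ((diag_sum he (lp.norm_apply_le_norm ENNReal.top_ne_zero a) w).1)]
        congr 1
        ext k
        rw [inner_add_right, mul_add, add_smul]
      map_smul' := fun c v => by
        rw [RingHom.id_apply,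
          ← ((diag_sum he (lp.norm_apply_le_norm ENNReal.top_ne_zero a) v).1).tsum_const_smul c]
        congr 1
        ext k
        rw [inner_smul_right, smul_smul]
        congr 1
        ring }
    ‖a‖ (fun v => (diag_sum he (lp.norm_apply_le_norm ENNReal.top_ne_zero a) v).2)

/-- The entries of `D_g x = ∑_{n ≥ 0} x_n g(2^n) χ_{[2^n, 2^(n+1))}` on the non-negative integers:
`0` at `k = 0` and `x_n g(2^n)` at `k` with `2^n ≤ k < 2^(n+1)`. -/
def DSeq (g : Weight) (x : Linf) (k : ℕ) : ℂ :=
  if k = 0 then 0 else x (Nat.log 2 k) * (g (2 ^ Nat.log 2 k) : ℝ)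

theorem DSeq_norm_le (g : Weight) (x : Linf) {k : ℕ} {t : ℝ} (ht : 0 < t)
    (htk : t < k + 1) : ‖DSeq g x k‖ ≤ ‖x‖ * g (t / 2) := by
  have hg := g.pos (t / 2) (by positivity)
  unfold DSeq
  split_ifs with hk
  · simpa using by positivity
  · have h2 : (0 : ℝ) < 2 ^ Nat.log 2 k := by positivity
    rw [norm_mul, Complex.norm_real, Real.norm_of_nonneg (g.pos _ h2).le]
    refine mul_le_mul (lp.norm_apply_le_norm ENNReal.top_ne_zero x _) ?_ (g.pos _ h2).le
      (norm_nonneg _)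
    refine g.anti (show (0 : ℝ) < t / 2 by positivity) h2 ?_
    have h : k + 1 ≤ 2 ^ (Nat.log 2 k + 1) := Nat.lt_pow_succ_log_self one_lt_two k
    have h' : (k : ℝ) + 1 ≤ 2 ^ (Nat.log 2 k + 1) := by exact_mod_cast h
    rw [pow_succ] at h'
    linarith

theorem DSeq_mem (g : Weight) (x : Linf) : Memℓp (DSeq g x) ∞ := by
  apply memℓp_infty
  refine ⟨‖x‖ * g ((1 / 2) / 2), ?_⟩
  rintro _ ⟨k, rfl⟩
  refine DSeq_norm_le g x (by norm_num) ?_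
  have : (0 : ℝ) ≤ k := k.cast_nonneg
  linarith

theorem diagOp_DSeq_mem (g : Weight) {e : ℕ → H} (he : Orthonormal ℂ e) (x : Linf) :
    diagOp he ⟨DSeq g x, DSeq_mem g x⟩ ∈ LIdeal H g := by
  obtain ⟨C, hC0, hC⟩ := g.exists_half_le
  refine ⟨‖x‖ * C, fun t ht => ?_⟩
  rw [div_le_iff₀ (g.pos t ht)]
  set n := ⌊t⌋₊ with hn
  let K : Submodule ℂ H := Submodule.span ℂ (Set.range fun i : Fin n => e i)
  have hK : FiniteDimensional ℂ K := FiniteDimensional.span_of_finite ℂ (Set.finite_range _)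
  have hd : (Module.finrank ℂ K : ℝ) ≤ t := by
    have h1 : Module.finrank ℂ K ≤ n := by
      have h0 := finrank_range_le_card (R := ℂ) (fun i : Fin n => e i)
      rwa [Fintype.card_fin] at h0
    exact (Nat.cast_le.mpr h1).trans (Nat.floor_le ht.le)
  refine (mu_le _ K hK hd).trans ?_
  have hg2 : 0 < g (t / 2) := g.pos _ (by positivity)
  have hle : ‖diagOp he ⟨DSeq g x, DSeq_mem g x⟩ ∘L Kᗮ.starProjection‖ ≤ ‖x‖ * g (t / 2) := by
    apply ContinuousLinearMap.opNorm_le_bound _ (by positivity)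
    intro v
    set w := Kᗮ.starProjection v with hw
    have hwK : w ∈ Kᗮ := Submodule.starProjection_apply_mem _ _
    let b : ℕ → ℂ := fun k => if k < n then 0 else DSeq g x k
    have hb : ∀ k, ‖b k‖ ≤ ‖x‖ * g (t / 2) := by
      intro k
      simp only [b]
      split_ifs with hk
      · simpa using by positivity
      · refine DSeq_norm_le g x ht ?_
        have h1 : t < n + 1 := Nat.lt_floor_add_one t
        have h2 : (n : ℝ) ≤ k := by exact_mod_cast not_lt.mp hk
        linarith
    have heq : (diagOp he ⟨DSeq g x, DSeq_mem g x⟩ ∘L Kᗮ.starProjection) v =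
        ∑' k, (b k * inner ℂ (e k) w) • e k := by
      change (∑' k, (DSeq g x k * inner ℂ (e k) w) • e k) = _
      congr 1
      ext k
      simp only [b]
      split_ifs with hk
      · have : inner ℂ (e k) w = 0 :=
          hwK (e k) (Submodule.subset_span ⟨⟨k, hk⟩, rfl⟩)
        simp [this]
      · rfl
    rw [heq]
    refine (diag_sum he hb w).2.trans ?_
    refine mul_le_mul_of_nonneg_left ?_ (by positivity)
    calc ‖w‖ ≤ ‖Kᗮ.starProjection‖ * ‖v‖ := ContinuousLinearMap.le_opNorm _ _
      _ ≤ ‖v‖ := mul_le_of_le_one_left (norm_nonneg _) (Submodule.starProjection_norm_le _)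
  calc _ ≤ ‖x‖ * g (t / 2) := hle
    _ ≤ ‖x‖ * (C * g t) := mul_le_mul_of_nonneg_left (hC t ht) (norm_nonneg _)
    _ = ‖x‖ * C * g t := by ring

/-- `𝒟_g : ℓ_∞ → L_g(H)`: the diagonal operator with entries `D_g x`. -/
def calD (g : Weight) {e : ℕ → H} (he : Orthonormal ℂ e) (x : Linf) : LIdeal H g :=
  ⟨diagOp he ⟨DSeq g x, DSeq_mem g x⟩, diagOp_DSeq_mem g he x⟩

/-- `ψ = i_{g,f}(φ)`, where `i_{g,f}(φ) = φ ∘ 𝒟_g ∘ Φ_f`. Since `Φ_f` is not additive, the formula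
is read on positive operators, and `ψ` is the linear extension. -/
def IsTransfer {g f : Weight} {e : ℕ → H} (he : Orthonormal ℂ e)
    (φ : LIdeal H g →ₗ[ℂ] ℂ) (ψ : LIdeal H f →ₗ[ℂ] ℂ) : Prop :=
  ∀ X : LIdeal H f, (X : H →L[ℂ] H).IsPositive → ψ X = φ (calD g he (Phi f X))

end Ideal

/-! ### The two weights and the test sequence -/

/-- `f(t) = 1` for `0 < t < 1` and `f(t) = 1 / t` for `t ≥ 1`. -/
def fW : Weight where
  toFun t := if t < 1 then 1 else 1 / t
  pos t ht := by split_ifs <;> positivity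
  anti := by
    intro s hs t ht hst
    simp only [mem_Ioi] at hs ht
    dsimp only
    split_ifs with h1 h2 h2
    · exact le_rfl
    · exact absurd (hst.trans_lt h1) h2
    · rw [div_le_one ht]; linarith
    · exact one_div_le_one_div_of_le hs hst
  tendsto_zero := by
    have h : Tendsto (fun t : ℝ => 1 / t) atTop (𝓝 0) := by
      simpa using tendsto_inv_atTop_zero (𝕜 := ℝ)
    refine h.congr' ?_
    filter_upwards [eventually_ge_atTop 1] with t ht
    rw [if_neg (not_lt.mpr ht)]
  doubling := by
    refine ⟨2, fun t ht => ?_⟩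
    split_ifs with h1 h2 h2
    · norm_num
    · rw [div_div_eq_mul_div]; linarith
    · linarith
    · apply le_of_eq; field_simp

theorem logb_two_ge_one {t : ℝ} (ht : 2 ≤ t) : 1 ≤ Real.logb 2 t := by
  rw [Real.le_logb_iff_rpow_le one_lt_two (by linarith)]
  simpa using ht

/-- `g(t) = 1 / 2` for `0 < t < 2` and `g(t) = 1 / (t log₂ t)` for `t ≥ 2`. -/
def gW : Weight where
  toFun t := if t < 2 then 1 / 2 else 1 / (t * Real.logb 2 t)
  pos t ht := by
    split_ifs with h
    · positivity
    · have := logb_two_ge_one (not_lt.mp h)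
      positivity
  anti := by
    intro s hs t ht hst
    simp only [mem_Ioi] at hs ht
    dsimp only
    split_ifs with h1 h2 h2
    · exact le_rfl
    · exact absurd (hst.trans_lt h1) h2
    · have h := logb_two_ge_one (not_lt.mp h1)
      apply one_div_le_one_div_of_le two_pos
      nlinarith
    · have h := logb_two_ge_one (not_lt.mp h2)
      have h' := Real.logb_le_logb_of_le one_lt_two hs hst
      apply one_div_le_one_div_of_le (by positivity)
      exact mul_le_mul hst h' (by linarith) ht.le
  tendsto_zero := by
    have h : Tendsto (fun t : ℝ => 1 / t) atTop (𝓝 0) := by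
      simpa using tendsto_inv_atTop_zero (𝕜 := ℝ)
    refine squeeze_zero' ?_ ?_ h
    · filter_upwards [eventually_ge_atTop 2] with t ht
      have := logb_two_ge_one ht
      rw [if_neg (not_lt.mpr ht)]
      positivity
    · filter_upwards [eventually_ge_atTop 2] with t ht
      have := logb_two_ge_one ht
      rw [if_neg (not_lt.mpr ht)]
      apply one_div_le_one_div_of_le (by linarith)
      nlinarith
  doubling := by
    refine ⟨4, fun t ht => ?_⟩
    have hl : Real.logb 2 (2 * t) = 1 + Real.logb 2 t := by
      rw [Real.logb_mul two_ne_zero ht.ne', Real.logb_self_eq_one one_lt_two]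
    split_ifs with h1 h2 h2
    · norm_num
    · have h := logb_two_ge_one (not_lt.mp h2)
      have h3 : Real.logb 2 t ≤ 1 := by
        rw [Real.logb_le_iff_le_rpow one_lt_two ht]
        simpa using h1.le
      rw [hl] at h ⊢
      rw [div_div_eq_mul_div]
      nlinarith
    · linarith
    · have h := logb_two_ge_one (not_lt.mp h1)
      rw [hl, div_div_eq_mul_div, div_mul_eq_mul_div, div_one, div_le_iff₀ (by positivity)]
      nlinarith

/-- The sequence `y = ∑_{n ≥ 1} χ_{[2^(2n), 2^(2n+1))}` of zeros and ones. -/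
def ySeq (k : ℕ) : ℂ :=
  open Classical in if ∃ n : ℕ, 1 ≤ n ∧ 2 ^ (2 * n) ≤ k ∧ k < 2 ^ (2 * n + 1) then 1 else 0

theorem ySeq_mem : Memℓp ySeq ∞ := by
  apply memℓp_infty
  refine ⟨1, ?_⟩
  rintro _ ⟨k, rfl⟩
  simp only [ySeq]
  split_ifs <;> simp

/-- The sequence `y` as an element of `ℓ_∞`. -/
def yInf : Linf := ⟨ySeq, ySeq_mem⟩

end

/-! Write S(N, X) for the sum of the first N singular values. The two weights sit on different
logarithmic scales. Since 2^j f(2^j) = 1 and F(n) = 1 + log n, a Dixmier trace on L_f evaluates an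
extended limit on Cesàro means in the variable j = log₂ n. Since 2^j g(2^j) = 1/j for j ≥ 1 and G(n)
= 1 + log 2 · log log₂ n, a Dixmier trace on L_g evaluates an extended limit on logarithmic means in
that variable (`dixmier_calD_gW`).

Φ_f(X) is the sequence of increments S(2^(j+1), X) - S(2^j, X), so its Cesàro means are, up to a
null sequence, the Dixmier averages of X at n = 2^j multiplied by log 2. Abel summation
(`logMean_sub_tendsto_zero`) shows that the logarithmic means of a sequence and of its Cesàro means
are asymptotic. Hence i_{g,f} sends the trace of ω to the trace of ω composed with logarithmic
averaging along powers of two, which is again an extended limit (`dixmier_calD_Phi`,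
`transferLimit_isExtendedLimit`). The image therefore sees only logarithmically averaged limits.

The sequence y separates these from general ones. It satisfies y_l = 1 - y_⌊l/2⌋ for l ≥ 4, so it
alternates on dyadic blocks. Its Cesàro means oscillate between 1/3 and 2/3, and extended limits of
them fill [1/3, 2/3]. Consecutive blocks carry almost equal logarithmic mass, so the logarithmic
means converge to 1/2 (`logMean_yInf_tendsto`), and a trace with another value at 𝒟_f y is not in
the image.

That the formulas define linear functionals rests on Ky Fan inequalities for positive X and Y: S(N,
X+Y) ≤ S(N, X) + S(N, Y) ≤ S(2N, X+Y). For these weights S(2N) - S(N) is bounded while the primitive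
tends to infinity, so the averages are additive in the limit (`sumMu_add_defect`); functionals on
the positive cone then extend uniquely. All other approximations work the same way: an error bounded
in n disappears after division by F or G. -/

/-! ### Singular values of positive operators -/

section Operators

variable {H : Type*} [NormedAddCommGroup H] [InnerProductSpace ℂ H]

/-- A positive operator vanishes on the orthogonal complement of its range. -/
theorem apply_eq_zero_of_mem_orthogonal_range [CompleteSpace H] {A : H →L[ℂ] H}
    (hA : A.IsPositive) {w : H} (hw : w ∈ (LinearMap.range (A : H →ₗ[ℂ] H))ᗮ) : A w = 0 := by
  have h : inner ℂ (A (A w)) w = 0 := hw _ ⟨A w, rfl⟩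
  rw [hA.inner_left_eq_inner_right] at h
  exact inner_self_eq_zero.mp h

/-- A positive operator vanishes where its quadratic form does. -/
theorem apply_eq_zero_of_inner_eq_zero [CompleteSpace H] {A : H →L[ℂ] H} (hA : A.IsPositive)
    {w : H} (hw : inner ℂ (A w) w = 0) : A w = 0 := by
  have hA0 : 0 ≤ A := (ContinuousLinearMap.nonneg_iff_isPositive A).mpr hA
  obtain ⟨S, hS⟩ := CStarAlgebra.nonneg_iff_eq_star_mul_self.mp hA0
  have h1 : A w = (ContinuousLinearMap.adjoint S) (S w) := by rw [hS]; rfl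
  rw [h1, ContinuousLinearMap.adjoint_inner_left] at hw
  rw [h1, inner_self_eq_zero.mp hw, map_zero]

/-- Splitting a positive operator at the level `r`: the part above `r` and the part below. -/
theorem exists_split_at_level [CompleteSpace H] {X : H →L[ℂ] H} (hX : X.IsPositive) {r : ℝ}
    (hr : 0 ≤ r) : ∃ A Y : H →L[ℂ] H, A.IsPositive ∧ X = A + Y ∧ ‖Y‖ ≤ r ∧
      ∀ v, X (A v) = A (A v) + (r : ℂ) • A v := by
  have hX0 : 0 ≤ X := (ContinuousLinearMap.nonneg_iff_isPositive X).mpr hX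
  have hsa : IsSelfAdjoint X := hX.isSelfAdjoint
  refine ⟨cfc (fun t : ℝ => max (t - r) 0) X, cfc (fun t : ℝ => min t r) X, ?_, ?_, ?_, ?_⟩
  · rw [← ContinuousLinearMap.nonneg_iff_isPositive]
    exact cfc_nonneg fun x _ => le_max_right _ _
  · rw [← cfc_add X (fun t : ℝ => max (t - r) 0) (fun t : ℝ => min t r)]
    conv_lhs => rw [← cfc_id ℝ X]
    congr 1
    ext t
    rcases le_total t r with h | h
    · simp [h]
    · simp [h]
  · apply norm_cfc_le hr
    intro x hx
    have hx0 : 0 ≤ x := spectrum_nonneg_of_nonneg hX0 hx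
    rw [Real.norm_of_nonneg (le_min hx0 hr)]
    exact min_le_right _ _
  · intro v
    -- The function (t - r)⁺ vanishes unless t ≥ r, and there t = (t - r)⁺ + r.
    have h : X * cfc (fun t : ℝ => max (t - r) 0) X =
        cfc (fun t : ℝ => max (t - r) 0) X * cfc (fun t : ℝ => max (t - r) 0) X +
          r • cfc (fun t : ℝ => max (t - r) 0) X := by
      conv_lhs => enter [1]; rw [← cfc_id ℝ X]
      rw [← cfc_mul id (fun t : ℝ => max (t - r) 0) X,
        ← cfc_mul (fun t : ℝ => max (t - r) 0) (fun t : ℝ => max (t - r) 0) X,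
        ← cfc_smul r (fun t : ℝ => max (t - r) 0) X,
        ← cfc_add X (fun t : ℝ => max (t - r) 0 * max (t - r) 0) (fun t : ℝ => r • max (t - r) 0)]
      congr 1
      ext t
      rcases le_total t r with h | h
      · simp [h]
      · simp only [id, smul_eq_mul, max_eq_left (sub_nonneg.mpr h)]
        ring
    have h' := congrArg (fun Z : H →L[ℂ] H => Z v) h
    simpa using h'

/-- If the quadratic form of `X ≥ 0` is at most `r` on a subspace of codimension `n`, then
`μ(n, X) ≤ r`. -/
theorem mu_le_of_quadForm_le [CompleteSpace H] {X : H →L[ℂ] H} (hX : X.IsPositive) {r t : ℝ}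
    (hr : 0 ≤ r) (K : Submodule ℂ H) [FiniteDimensional ℂ K] (hd : (Module.finrank ℂ K : ℝ) ≤ t)
    (hK : ∀ v ∈ Kᗮ, (inner ℂ (X v) v).re ≤ r * ‖v‖ ^ 2) : mu t X ≤ r := by
  obtain ⟨A, Y, hA, hXA, hY, hXAA⟩ := exists_split_at_level hX hr
  set R := LinearMap.range (A : H →ₗ[ℂ] H) with hR
  -- The range of A = (X - r)⁺ meets Kᗮ only in 0: on such a vector the form of X is that of A plus
  -- r‖·‖², so the hypothesis makes the form of A vanish. Hence dim R ≤ dim K, while X agrees on Rᗮ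
  -- with Y, whose norm is at most r.
  have hinj : Function.Injective
      ((K.orthogonalProjectionOnto : H →L[ℂ] K).toLinearMap ∘ₗ R.subtype) := by
    rw [← LinearMap.ker_eq_bot, LinearMap.ker_eq_bot']
    rintro ⟨w, u, rfl⟩ hw
    have hw' : A u ∈ Kᗮ := by
      rw [← Submodule.orthogonalProjectionOnto_eq_zero_iff]
      exact hw
    have h1 := hK _ hw'
    rw [hXAA, inner_add_left, Complex.add_re, inner_smul_left, Complex.conj_ofReal,
      Complex.re_ofReal_mul, inner_self_eq_norm_sq_to_K] at h1
    have h2 : (((‖A u‖ : ℂ)) ^ 2).re = ‖A u‖ ^ 2 := by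
      rw [← Complex.ofReal_pow, Complex.ofReal_re]
    have h3 := hA.inner_nonneg_left (A u)
    rw [Complex.nonneg_iff] at h3
    have h4 : inner ℂ (A (A u)) (A u) = 0 := by
      apply Complex.ext
      · refine le_antisymm ?_ h3.1
        have h5 : (inner ℂ (A (A u)) (A u)).re + r * ‖A u‖ ^ 2 ≤ r * ‖A u‖ ^ 2 := by
          rw [← h2]; rw [← h2] at h1; exact h1
        simpa using h5
      · exact h3.2.symm
    have h5 := apply_eq_zero_of_inner_eq_zero hA h4
    have h6 : inner ℂ (A u) (A u) = 0 := by
      rw [← hA.inner_left_eq_inner_right, h5, inner_zero_left]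
    exact Subtype.ext (inner_self_eq_zero.mp h6)
  have : FiniteDimensional ℂ R := Module.Finite.of_injective _ hinj
  have hfin : Module.finrank ℂ R ≤ Module.finrank ℂ K :=
    LinearMap.finrank_le_finrank_of_injective hinj
  refine (mu_le X R this ((Nat.cast_le.mpr hfin).trans hd)).trans ?_
  apply ContinuousLinearMap.opNorm_le_bound _ hr
  intro v
  have hv : Rᗮ.starProjection v ∈ Rᗮ := Submodule.starProjection_apply_mem _ _
  have h0 := apply_eq_zero_of_mem_orthogonal_range hA hv
  have h1 : (X ∘L Rᗮ.starProjection) v = Y (Rᗮ.starProjection v) := by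
    rw [ContinuousLinearMap.comp_apply, hXA, _root_.add_apply, h0, zero_add]
  rw [h1]
  refine (Y.le_opNorm _).trans (mul_le_mul hY ?_ (norm_nonneg _) hr)
  calc ‖Rᗮ.starProjection v‖ ≤ ‖Rᗮ.starProjection‖ * ‖v‖ := ContinuousLinearMap.le_opNorm _ _
    _ ≤ ‖v‖ := mul_le_of_le_one_left (norm_nonneg _) (Submodule.starProjection_norm_le _)

theorem mu_eq_mu_floor [CompleteSpace H] {t : ℝ} (ht : 0 ≤ t) (X : H →L[ℂ] H) :
    mu t X = mu (⌊t⌋₊ : ℝ) X := by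
  unfold mu
  congr 1
  ext r
  simp only [mem_ofPred_eq, Nat.cast_le, Nat.le_floor_iff ht]

/-- The sum of the first `N` singular values. -/
noncomputable def sumMu [CompleteSpace H] (N : ℕ) (X : H →L[ℂ] H) : ℝ :=
  ∑ k ∈ Finset.range N, mu k X

/-- The compression of `X` to a finite-dimensional subspace. -/
noncomputable def compress (W : Submodule ℂ H) [FiniteDimensional ℂ W] (X : H →L[ℂ] H) :
    W →ₗ[ℂ] W :=
  ((W.orthogonalProjectionOnto ∘L X ∘L W.subtypeL : W →L[ℂ] W) : W →ₗ[ℂ] W)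

/-! ### Compressions and the Ky Fan variational principle -/

theorem inner_compress (W : Submodule ℂ H) [FiniteDimensional ℂ W] (X : H →L[ℂ] H) (v w : W) :
    inner ℂ (compress W X v) w = inner ℂ (X v) (w : H) := by
  exact W.inner_orthogonalProjectionOnto_eq_of_mem_right w (X v)

theorem compress_isPositive (W : Submodule ℂ H) [FiniteDimensional ℂ W] {X : H →L[ℂ] H}
    (hX : X.IsPositive) : (compress W X).IsPositive :=
  hX.orthogonalProjectionOnto_comp W

/-- Both sides are the trace of the compression of X to W. -/
theorem sum_inner_eq_of_orthonormalBasis {ι κ : Type*} [Fintype ι] [Fintype κ]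
    (W : Submodule ℂ H) [FiniteDimensional ℂ W] {X : H →L[ℂ] H} (hX : X.IsPositive)
    (b : OrthonormalBasis ι ℂ W) (c : OrthonormalBasis κ ℂ W) :
    ∑ i, inner ℂ (X (b i)) (b i : H) = ∑ i, inner ℂ (X (c i)) (c i : H) := by
  have h1 := (compress W X).trace_eq_sum_inner b
  have h2 := (compress W X).trace_eq_sum_inner c
  rw [h1] at h2
  simpa only [← (compress_isPositive W hX).isSymmetric _ _, inner_compress] using h2

/-- Min-max argument: if dim K ≤ k, the span of the first k + 1 eigenvectors of the compression
contains a nonzero vector of Kᗮ. On it the form of X is at least λ_k‖v‖² and at most ‖X P‖‖v‖². -/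
theorem eigenvalues_compress_le_mu [CompleteSpace H] {X : H →L[ℂ] H} (hX : X.IsPositive)
    (W : Submodule ℂ H) [FiniteDimensional ℂ W] {N : ℕ} (hN : Module.finrank ℂ W = N)
    (k : Fin N) :
    (compress_isPositive W hX).isSymmetric.eigenvalues hN k ≤ mu (k : ℕ) X := by
  set hT := (compress_isPositive W hX).isSymmetric
  set b := hT.eigenvectorBasis hN
  set l := hT.eigenvalues hN
  apply le_csInf (mu_nonempty (Nat.cast_nonneg _) X)
  rintro _ ⟨K, hKf, hKd, rfl⟩
  rw [Nat.cast_le] at hKd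
  let ι : Fin (k + 1) → Fin N := Fin.castLE k.2
  let F : (Fin (k + 1) → ℂ) →ₗ[ℂ] W := Fintype.linearCombination ℂ fun i => b (ι i)
  have hF : ∀ c, F c = ∑ i, c i • b (ι i) := fun c => Fintype.linearCombination_apply _ _ _
  have hker : LinearMap.ker
      ((K.orthogonalProjectionOnto : H →L[ℂ] K).toLinearMap ∘ₗ W.subtype ∘ₗ F) ≠ ⊥ := by
    apply LinearMap.ker_ne_bot_of_finrank_lt
    rw [Module.finrank_fin_fun]
    omega
  obtain ⟨c, hc, hc0⟩ := (Submodule.ne_bot_iff _).mp hker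
  have hv : ((F c : W) : H) ∈ Kᗮ := by
    rw [← Submodule.orthogonalProjectionOnto_eq_zero_iff]
    exact hc
  have hbι : Orthonormal ℂ fun i => b (ι i) :=
    b.orthonormal.comp ι (Fin.castLE_injective _)
  have hTF : compress W X (F c) = ∑ i, ((l (ι i) : ℂ) * c i) • b (ι i) := by
    rw [hF, map_sum]
    refine Finset.sum_congr rfl fun i _ => ?_
    rw [map_smul, hT.apply_eigenvectorBasis hN, smul_smul, mul_comm]
    rfl
  have hin : inner ℂ (X (F c)) ((F c : W) : H) = ((∑ i, l (ι i) * ‖c i‖ ^ 2 : ℝ) : ℂ) := by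
    rw [← inner_compress, hTF, hF, hbι.inner_sum, Complex.ofReal_sum]
    refine Finset.sum_congr rfl fun i _ => ?_
    rw [map_mul, Complex.conj_ofReal, mul_assoc, Complex.conj_mul']
    push_cast
    rfl
  have hnorm : ‖F c‖ ^ 2 = ∑ i, ‖c i‖ ^ 2 := by
    have h := hbι.inner_sum c c Finset.univ
    rw [← hF, inner_self_eq_norm_sq_to_K] at h
    have h' : (∑ i, (starRingEnd ℂ) (c i) * c i) = ((∑ i, ‖c i‖ ^ 2 : ℝ) : ℂ) := by
      rw [Complex.ofReal_sum]
      refine Finset.sum_congr rfl fun i _ => ?_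
      rw [Complex.conj_mul']
      push_cast
      rfl
    rw [h'] at h
    exact Complex.ofReal_injective (by rw [← h]; push_cast; rfl)
  have hpos : 0 < ‖F c‖ ^ 2 := by
    rw [hnorm]
    obtain ⟨i, hi⟩ := Function.ne_iff.mp hc0
    exact Finset.sum_pos' (fun _ _ => by positivity)
      ⟨i, Finset.mem_univ _, pow_pos (norm_pos_iff.mpr hi) 2⟩
  have hlow : l k * ‖F c‖ ^ 2 ≤ (inner ℂ (X (F c)) ((F c : W) : H)).re := by
    rw [hin, Complex.ofReal_re, hnorm, Finset.mul_sum]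
    refine Finset.sum_le_sum fun i _ => mul_le_mul_of_nonneg_right ?_ (by positivity)
    apply hT.eigenvalues_antitone hN
    rw [Fin.le_def]
    exact Nat.lt_succ_iff.mp i.2
  have hXP : X (F c) = (X ∘L Kᗮ.starProjection) (F c) := by
    rw [ContinuousLinearMap.comp_apply, Submodule.starProjection_eq_self_iff.mpr hv]
  have hup : (inner ℂ (X (F c)) ((F c : W) : H)).re ≤ ‖X ∘L Kᗮ.starProjection‖ * ‖F c‖ ^ 2 := by
    refine (Complex.re_le_norm _).trans ((norm_inner_le_norm _ _).trans ?_)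
    rw [hXP, sq, ← mul_assoc]
    exact mul_le_mul_of_nonneg_right (ContinuousLinearMap.le_opNorm _ _) (norm_nonneg _)
  exact le_of_mul_le_mul_right (hlow.trans hup) hpos

/-- For an orthonormal family of `N` vectors, the diagonal of a positive operator is dominated by
the sum of its first `N` singular values. -/
theorem sum_inner_basis_le_sumMu [CompleteSpace H] {X : H →L[ℂ] H} (hX : X.IsPositive)
    (W : Submodule ℂ H) [FiniteDimensional ℂ W] {ι : Type*} [Fintype ι]
    (b : OrthonormalBasis ι ℂ W) :
    ∑ i, (inner ℂ (X (b i)) (b i : H)).re ≤ sumMu (Module.finrank ℂ W) X := by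
  have hT := (compress_isPositive W hX).isSymmetric
  rw [← Complex.re_sum, sum_inner_eq_of_orthonormalBasis W hX b (hT.eigenvectorBasis rfl),
    Complex.re_sum, sumMu, ← Fin.sum_univ_eq_sum_range (fun k => mu (k : ℝ) X)]
  refine Finset.sum_le_sum fun i _ => ?_
  rw [← inner_compress, hT.apply_eigenvectorBasis, inner_smul_left]
  simpa using eigenvalues_compress_le_mu hX W rfl i

theorem sumMu_mono [CompleteSpace H] {M N : ℕ} (h : M ≤ N) (X : H →L[ℂ] H) :
    sumMu M X ≤ sumMu N X :=
  Finset.sum_le_sum_of_subset_of_nonneg (Finset.range_subset_range.mpr h)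
    fun _ _ _ => mu_nonneg _ _

theorem sum_inner_le_sumMu [CompleteSpace H] {X : H →L[ℂ] H} (hX : X.IsPositive) {N : ℕ}
    {u : Fin N → H} (hu : Orthonormal ℂ u) :
    ∑ i, (inner ℂ (X (u i)) (u i)).re ≤ sumMu N X := by
  let W : Submodule ℂ H := Submodule.span ℂ (Set.range u)
  have : FiniteDimensional ℂ W := FiniteDimensional.span_of_finite ℂ (Set.finite_range u)
  have hu' : Orthonormal ℂ fun i => (⟨u i, Submodule.subset_span ⟨i, rfl⟩⟩ : W) := by
    rw [orthonormal_iff_ite] at hu ⊢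
    exact hu
  have hfin : Module.finrank ℂ W = N := by
    simpa using finrank_span_eq_card hu.linearIndependent
  have hspan : ⊤ ≤ Submodule.span ℂ
      (Set.range fun i => (⟨u i, Submodule.subset_span ⟨i, rfl⟩⟩ : W)) := by
    rw [hu'.linearIndependent.span_eq_top_of_card_eq_finrank' (by rw [hfin, Fintype.card_fin])]
  have h := sum_inner_basis_le_sumMu hX W (OrthonormalBasis.mk hu' hspan)
  rw [hfin] at h
  simpa using h

/-- Extending u to an orthonormal basis of W only adds nonnegative diagonal terms, and the total
does not depend on the basis. -/
theorem sum_inner_le_sum_inner_basis {X : H →L[ℂ] H} (hX : X.IsPositive) {N : ℕ} {u : Fin N → H}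
    (hu : Orthonormal ℂ u) (W : Submodule ℂ H) [FiniteDimensional ℂ W] (huW : ∀ i, u i ∈ W)
    {ι : Type*} [Fintype ι] (b : OrthonormalBasis ι ℂ W) :
    ∑ i, (inner ℂ (X (u i)) (u i)).re ≤ ∑ i, (inner ℂ (X (b i)) (b i : H)).re := by
  classical
  let v : Fin N → W := fun i => ⟨u i, huW i⟩
  have hv : Orthonormal ℂ v := by
    rw [orthonormal_iff_ite] at hu ⊢
    exact hu
  have hinj : Function.Injective v := hv.linearIndependent.injective
  obtain ⟨s, c, hs, hc⟩ :=
    ((orthonormal_subtype_range hinj).mpr hv).exists_orthonormalBasis_extension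
  rw [← Complex.re_sum (f := fun i => inner ℂ (X (b i)) (b i : H)),
    sum_inner_eq_of_orthonormalBasis W hX b c, Complex.re_sum, hc]
  have h1 : ∑ i, (inner ℂ (X (u i)) (u i)).re =
      ∑ w ∈ Finset.univ.image v, (inner ℂ (X (w : H)) (w : H)).re := by
    rw [Finset.sum_image fun _ _ _ _ h => hinj h]
  rw [h1, Finset.sum_coe_sort s (fun w : W => (inner ℂ (X (w : H)) (w : H)).re)]
  refine Finset.sum_le_sum_of_subset_of_nonneg ?_ fun w _ _ => ?_
  · intro w hw
    obtain ⟨i, -, rfl⟩ := Finset.mem_image.mp hw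
    exact hs ⟨i, rfl⟩
  · exact hX.re_inner_nonneg_left _

/-- The sum of the first `N` singular values is approximated by diagonals. -/
theorem exists_orthonormal_sumMu_le [CompleteSpace H] (hH : ¬ FiniteDimensional ℂ H)
    {X : H →L[ℂ] H} (hX : X.IsPositive) {ε : ℝ} (hε : 0 < ε) (N : ℕ) :
    ∃ u : Fin N → H, Orthonormal ℂ u ∧
      sumMu N X ≤ ∑ i, (inner ℂ (X (u i)) (u i)).re + N * ε := by
  induction N with
  | zero => exact ⟨Fin.elim0, by simp [Orthonormal, Pairwise], by simp [sumMu]⟩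
  | succ N ih =>
    obtain ⟨u, hu, hle⟩ := ih
    let K : Submodule ℂ H := Submodule.span ℂ (Set.range u)
    have hKf : FiniteDimensional ℂ K := FiniteDimensional.span_of_finite ℂ (Set.finite_range u)
    have hKd : Module.finrank ℂ K ≤ N := 
      (finrank_range_le_card (R := ℂ) u).trans_eq (Fintype.card_fin N)
    have hKne : Kᗮ ≠ ⊥ := by
      intro h
      rw [Submodule.orthogonal_eq_bot_iff] at h
      apply hH
      rw [h] at hKf
      exact Module.Finite.of_surjective (⊤ : Submodule ℂ H).subtype
        fun x => ⟨⟨x, trivial⟩, rfl⟩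
    -- Otherwise the form of X on Kᗮ would be bounded by μ(N) - ε, and `mu_le_of_quadForm_le` would
    -- give μ(N) ≤ μ(N) - ε. Infinite dimension supplies a nonzero vector in Kᗮ, whose form shows
    -- that this bound is nonnegative.
    have key : ∃ v ∈ Kᗮ, ‖v‖ = 1 ∧ mu (N : ℝ) X - ε ≤ (inner ℂ (X v) v).re := by
      by_contra! hcon
      obtain ⟨w, hwK, hw0⟩ := (Submodule.ne_bot_iff _).mp hKne
      have hunit : ∀ v : H, v ≠ 0 → ‖((‖v‖ : ℂ)⁻¹) • v‖ = 1 := fun v hv => by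
        simp [norm_smul, hv]
      have hr : 0 ≤ mu (N : ℝ) X - ε := by
        have := hcon _ (Kᗮ.smul_mem ((‖w‖ : ℂ)⁻¹) hwK) (hunit w hw0)
        exact (hX.re_inner_nonneg_left _).trans this.le
      have := mu_le_of_quadForm_le hX (t := N) hr K (by exact_mod_cast hKd) (by
        intro v hv
        by_cases hv0 : v = 0
        · simp [hv0]
        have h1 := hcon _ (Kᗮ.smul_mem ((‖v‖ : ℂ)⁻¹) hv) (hunit v hv0)
        have hvpos : 0 < ‖v‖ := norm_pos_iff.mpr hv0
        rw [map_smul, inner_smul_left, inner_smul_right, ← Complex.ofReal_inv,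
          Complex.conj_ofReal, Complex.re_ofReal_mul, Complex.re_ofReal_mul, ← mul_assoc,
          ← mul_inv, ← sq, inv_mul_lt_iff₀ (by positivity)] at h1
        linarith)
      linarith
    obtain ⟨v, hvK, hv1, hv⟩ := key
    have hvu : ∀ i, inner ℂ (u i) v = 0 := fun i => hvK _ (Submodule.subset_span ⟨i, rfl⟩)
    refine ⟨Fin.snoc u v, ?_, ?_⟩
    · rw [orthonormal_iff_ite] at hu ⊢
      intro i j
      induction i using Fin.lastCases with
      | last =>
        induction j using Fin.lastCases with
        | last => simp [inner_self_eq_norm_sq_to_K, hv1]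
        | cast j =>
          simp [inner_eq_zero_symm.mp (hvu j), (Fin.castSucc_lt_last j).ne']
      | cast i =>
        induction j using Fin.lastCases with
        | last => simp [hvu i, (Fin.castSucc_lt_last i).ne]
        | cast j => simpa using hu i j
    · rw [Fin.sum_univ_castSucc]
      simp only [Fin.snoc_castSucc, Fin.snoc_last]
      rw [sumMu, Finset.sum_range_succ, ← sumMu]
      push_cast
      linarith

/-- A family nearly optimal for X + Y is a competitor for X and for Y. -/
theorem sumMu_add_le [CompleteSpace H] (hH : ¬ FiniteDimensional ℂ H) {X Y : H →L[ℂ] H}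
    (hX : X.IsPositive) (hY : Y.IsPositive) (N : ℕ) :
    sumMu N (X + Y) ≤ sumMu N X + sumMu N Y := by
  apply le_of_forall_pos_le_add
  intro δ hδ
  obtain ⟨u, hu, h⟩ := exists_orthonormal_sumMu_le hH (hX.add hY)
    (div_pos hδ (Nat.cast_add_one_pos N)) N
  have h1 := sum_inner_le_sumMu hX hu
  have h2 := sum_inner_le_sumMu hY hu
  have h3 : (N : ℝ) * (δ / (N + 1)) ≤ δ := by
    rw [mul_div_assoc', div_le_iff₀ (Nat.cast_add_one_pos N)]
    nlinarith
  simp only [_root_.add_apply, inner_add_left, Complex.add_re,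
    Finset.sum_add_distrib] at h
  linarith

/-- The spans of families nearly optimal for X and for Y lie in one space of dimension at most 2N,
over which the diagonal sums of X and of Y dominate both. -/
theorem sumMu_add_sumMu_le [CompleteSpace H] (hH : ¬ FiniteDimensional ℂ H) {X Y : H →L[ℂ] H}
    (hX : X.IsPositive) (hY : Y.IsPositive) (N : ℕ) :
    sumMu N X + sumMu N Y ≤ sumMu (2 * N) (X + Y) := by
  apply le_of_forall_pos_le_add
  intro δ hδ
  have hε : 0 < δ / (2 * (N + 1)) := by positivity
  obtain ⟨u, hu, h⟩ := exists_orthonormal_sumMu_le hH hX hε N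
  obtain ⟨v, hv, h'⟩ := exists_orthonormal_sumMu_le hH hY hε N
  have h3 : (N : ℝ) * (δ / (2 * (N + 1))) ≤ δ / 2 := by
    rw [mul_div_assoc', div_le_iff₀ (by positivity)]
    nlinarith
  let U : Submodule ℂ H := Submodule.span ℂ (Set.range u)
  let V : Submodule ℂ H := Submodule.span ℂ (Set.range v)
  have : FiniteDimensional ℂ U := FiniteDimensional.span_of_finite ℂ (Set.finite_range u)
  have : FiniteDimensional ℂ V := FiniteDimensional.span_of_finite ℂ (Set.finite_range v)
  have hUd : Module.finrank ℂ U ≤ N :=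
    (finrank_range_le_card (R := ℂ) u).trans_eq (Fintype.card_fin N)
  have hVd : Module.finrank ℂ V ≤ N :=
    (finrank_range_le_card (R := ℂ) v).trans_eq (Fintype.card_fin N)
  have hd : Module.finrank ℂ (U ⊔ V : Submodule ℂ H) ≤ 2 * N := by
    have := Submodule.finrank_add_le_finrank_add_finrank U V
    omega
  have b := stdOrthonormalBasis ℂ (U ⊔ V : Submodule ℂ H)
  have h1 := sum_inner_le_sum_inner_basis hX hu (U ⊔ V)
    (fun i => Submodule.mem_sup_left (Submodule.subset_span ⟨i, rfl⟩)) b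
  have h2 := sum_inner_le_sum_inner_basis hY hv (U ⊔ V)
    (fun i => Submodule.mem_sup_right (Submodule.subset_span ⟨i, rfl⟩)) b
  have h4 := (sum_inner_basis_le_sumMu (hX.add hY) (U ⊔ V) b).trans (sumMu_mono hd _)
  simp only [_root_.add_apply, inner_add_left, Complex.add_re,
    Finset.sum_add_distrib] at h4
  linarith

end Operators

/-! ### Diagonal operators -/

section Diagonal

variable {H : Type*} [NormedAddCommGroup H] [InnerProductSpace ℂ H] [CompleteSpace H]

theorem hasSum_diagOp {e : ℕ → H} (he : Orthonormal ℂ e) (a : Linf) (v : H) :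
    HasSum (fun k => (a k * inner ℂ (e k) v) • e k) (diagOp he a v) :=
  (diag_sum he (lp.norm_apply_le_norm ENNReal.top_ne_zero a) v).1.hasSum

theorem hasSum_inner_diagOp {e : ℕ → H} (he : Orthonormal ℂ e) {a : Linf} {b : ℕ → ℝ}
    (hab : ∀ k, a k = b k) (v : H) :
    HasSum (fun k => ((b k * ‖inner ℂ (e k) v‖ ^ 2 : ℝ) : ℂ)) (inner ℂ v (diagOp he a v)) := by
  have h := (hasSum_diagOp he a v).mapL (innerSL ℂ v)
  rw [innerSL_apply_apply] at h
  convert! h using 2 with k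
  rw [innerSL_apply_apply, inner_smul_right, hab, mul_assoc, ← inner_conj_symm v (e k),
    Complex.mul_conj']
  push_cast
  rfl

theorem inner_diagOp_eq_re {e : ℕ → H} (he : Orthonormal ℂ e) {a : Linf} {b : ℕ → ℝ}
    (hab : ∀ k, a k = b k) (v : H) :
    HasSum (fun k => b k * ‖inner ℂ (e k) v‖ ^ 2) (inner ℂ (diagOp he a v) v).re ∧
      (((inner ℂ (diagOp he a v) v).re : ℝ) : ℂ) = inner ℂ (diagOp he a v) v := by
  have h := hasSum_inner_diagOp he hab v
  have hre : HasSum (fun k => b k * ‖inner ℂ (e k) v‖ ^ 2) (inner ℂ v (diagOp he a v)).re := by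
    simpa only [Complex.ofReal_re] using Complex.hasSum_re h
  have him : (inner ℂ v (diagOp he a v)).im = 0 := by
    have h0 := Complex.hasSum_im h
    simp only [Complex.ofReal_im] at h0
    exact h0.unique hasSum_zero
  have hc := inner_conj_symm (𝕜 := ℂ) (diagOp he a v) v
  have hre' : (inner ℂ (diagOp he a v) v).re = (inner ℂ v (diagOp he a v)).re := by
    rw [← hc, Complex.conj_re]
  refine ⟨hre' ▸ hre, Complex.ext (by simp) ?_⟩
  rw [← hc, Complex.conj_im, him]
  simp

theorem diagOp_isPositive {e : ℕ → H} (he : Orthonormal ℂ e) {a : Linf} {b : ℕ → ℝ}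
    (hab : ∀ k, a k = b k) (hb : ∀ k, 0 ≤ b k) : (diagOp he a).IsPositive := by
  rw [ContinuousLinearMap.isPositive_iff_complex]
  intro v
  obtain ⟨h1, h2⟩ := inner_diagOp_eq_re he hab v
  exact ⟨h2, h1.nonneg fun k => mul_nonneg (hb k) (by positivity)⟩

/-- The singular values of a positive diagonal operator dominate its entries. -/
theorem sum_le_sumMu_diagOp {e : ℕ → H} (he : Orthonormal ℂ e) {a : Linf} {b : ℕ → ℝ}
    (hab : ∀ k, a k = b k) (hb : ∀ k, 0 ≤ b k) (N : ℕ) :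
    ∑ k ∈ Finset.range N, b k ≤ sumMu N (diagOp he a) := by
  have h := sum_inner_le_sumMu (diagOp_isPositive he hab hb)
    (he.comp (fun i : Fin N => (i : ℕ)) Fin.val_injective)
  refine le_trans (le_of_eq ?_) h
  rw [← Fin.sum_univ_eq_sum_range b]
  refine Finset.sum_congr rfl fun i _ => ?_
  refine HasSum.unique ?_ (inner_diagOp_eq_re he hab (e i)).1
  have hi := hasSum_ite_eq (i : ℕ) (b i)
  convert! hi using 2 with k
  rw [orthonormal_iff_ite.mp he]
  split_ifs with hk
  · subst hk; simp
  · simp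

/-- Outside the first `M` entries, each singular value of a positive diagonal operator is bounded
by the supremum of the entries. -/
theorem sumMu_diagOp_le {e : ℕ → H} (he : Orthonormal ℂ e) (hH : ¬ FiniteDimensional ℂ H)
    {a : Linf} {b : ℕ → ℝ} (hab : ∀ k, a k = b k) (hb : ∀ k, 0 ≤ b k) (M N : ℕ) {c : ℝ}
    (hc0 : 0 ≤ c) (hc : ∀ k, M ≤ k → b k ≤ c) :
    sumMu N (diagOp he a) ≤ ∑ k ∈ Finset.range M, b k + N * c := by
  apply le_of_forall_pos_le_add
  intro δ hδ
  obtain ⟨u, hu, h⟩ := exists_orthonormal_sumMu_le hH (diagOp_isPositive he hab hb)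
    (div_pos hδ (Nat.cast_add_one_pos N)) N
  have h3 : (N : ℝ) * (δ / (N + 1)) ≤ δ := by
    rw [mul_div_assoc', div_le_iff₀ (Nat.cast_add_one_pos N)]
    nlinarith
  -- Bessel's inequality is used twice: for e against the unit vector u i, which leaves one c per
  -- vector in the tail, and below for u against e k, which leaves each b k with k < M at most once.
  have hi : ∀ i, (inner ℂ (diagOp he a (u i)) (u i)).re ≤
      ∑ k ∈ Finset.range M, b k * ‖inner ℂ (e k) (u i)‖ ^ 2 + c := by
    intro i
    have h1 := (inner_diagOp_eq_re he hab (u i)).1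
    have h2 : HasSum (fun k => if k ∈ Finset.range M then b k * ‖inner ℂ (e k) (u i)‖ ^ 2 else 0)
        (∑ k ∈ Finset.range M, b k * ‖inner ℂ (e k) (u i)‖ ^ 2) := by
      have h := hasSum_sum_of_ne_finset_zero (s := Finset.range M) (f := fun k =>
        if k ∈ Finset.range M then b k * ‖inner ℂ (e k) (u i)‖ ^ 2 else 0)
        (L := SummationFilter.unconditional ℕ) fun k hk => by rw [if_neg hk]
      rwa [Finset.sum_congr rfl fun k hk => if_pos hk] at h
    have h4 : HasSum (fun k => c * ‖inner ℂ (e k) (u i)‖ ^ 2)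
        (c * ∑' k, ‖inner ℂ (e k) (u i)‖ ^ 2) :=
      (he.inner_products_summable (u i)).hasSum.mul_left c
    have h5 := hasSum_le (fun k => ?_) h1 (h2.add h4)
    · have h6 := he.tsum_inner_products_le (u i)
      rw [hu.1 i, one_pow] at h6
      nlinarith
    · have h0 : 0 ≤ ‖inner ℂ (e k) (u i)‖ ^ 2 := by positivity
      split_ifs with hk
      · nlinarith [mul_nonneg hc0 h0]
      · rw [zero_add]
        exact mul_le_mul_of_nonneg_right (hc k (by simpa using hk)) h0
  have hsum := Finset.sum_le_sum fun i (_ : i ∈ Finset.univ) => hi i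
  rw [Finset.sum_add_distrib, Finset.sum_comm] at hsum
  have hB : ∑ k ∈ Finset.range M, ∑ i, b k * ‖inner ℂ (e k) (u i)‖ ^ 2 ≤
      ∑ k ∈ Finset.range M, b k := by
    refine Finset.sum_le_sum fun k _ => ?_
    rw [← Finset.mul_sum]
    refine mul_le_of_le_one_right (hb k) ?_
    have := hu.sum_inner_products_le (e k) (s := Finset.univ)
    rw [he.1 k, one_pow] at this
    simpa only [norm_inner_symm (e k)] using this
  simp only [Finset.sum_const, Finset.card_univ, Fintype.card_fin, nsmul_eq_mul] at hsum
  linarith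

end Diagonal

/-! ### The positive cone of an ideal -/

section Cone

variable {H : Type*} [NormedAddCommGroup H] [InnerProductSpace ℂ H] [CompleteSpace H]

theorem LIdeal.mem_of_mu_le {g : Weight} {X Y : H →L[ℂ] H} (hX : X ∈ LIdeal H g)
    (h : ∀ t, 0 < t → mu t Y ≤ mu t X) : Y ∈ LIdeal H g := by
  obtain ⟨C, hC⟩ := hX
  exact ⟨C, fun t ht => (div_le_div_of_nonneg_right (h t ht) (g.pos t ht).le).trans (hC t ht)⟩

theorem mu_le_mu_of_norm_le {t : ℝ} (ht : 0 ≤ t) {X Y : H →L[ℂ] H}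
    (h : ∀ v, ‖Y v‖ ≤ ‖X v‖) : mu t Y ≤ mu t X := by
  apply le_csInf (mu_nonempty ht X)
  rintro _ ⟨K, hK, hd, rfl⟩
  exact (mu_le Y K hK hd).trans (ContinuousLinearMap.opNorm_le_bound _ (norm_nonneg _)
    fun v => (h _).trans ((X ∘L Kᗮ.starProjection).le_opNorm v))

/-- For L = X(K) the adjoint maps Lᗮ into Kᗮ, and dim L ≤ dim K. With z = X* w one has ‖z‖² = ⟨X z,
w⟩, where z ∈ Kᗮ, so only ‖X P‖ enters. -/
theorem mu_adjoint_le {t : ℝ} (ht : 0 ≤ t) (X : H →L[ℂ] H) :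
    mu t (ContinuousLinearMap.adjoint X) ≤ mu t X := by
  apply le_csInf (mu_nonempty ht X)
  rintro _ ⟨K, hK, hd, rfl⟩
  let L : Submodule ℂ H := K.map (X : H →ₗ[ℂ] H)
  have hL : FiniteDimensional ℂ L := inferInstance
  have hLd : (Module.finrank ℂ L : ℝ) ≤ t :=
    (Nat.cast_le.mpr (Submodule.finrank_map_le _ K)).trans hd
  refine (mu_le _ L hL hLd).trans (ContinuousLinearMap.opNorm_le_bound _ (norm_nonneg _) ?_)
  intro v
  set w := Lᗮ.starProjection v with hw
  have hwL : w ∈ Lᗮ := Submodule.starProjection_apply_mem _ _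
  set z := ContinuousLinearMap.adjoint X w with hz
  have hzK : z ∈ Kᗮ := by
    intro k hk
    rw [hz, ContinuousLinearMap.adjoint_inner_right]
    exact hwL _ ⟨k, hk, rfl⟩
  have hwv : ‖w‖ ≤ ‖v‖ :=
    (ContinuousLinearMap.le_opNorm _ _).trans
      (mul_le_of_le_one_left (norm_nonneg _) (Submodule.starProjection_norm_le _))
  have h1 : ‖z‖ * ‖z‖ ≤ ‖z‖ * (‖X ∘L Kᗮ.starProjection‖ * ‖v‖) := by
    have h2 : X z = (X ∘L Kᗮ.starProjection) z := by
      rw [ContinuousLinearMap.comp_apply, Submodule.starProjection_eq_self_iff.mpr hzK]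
    calc ‖z‖ * ‖z‖ = ‖inner ℂ z z‖ := by
          rw [inner_self_eq_norm_sq_to_K, norm_pow, sq]; simp
      _ = ‖inner ℂ (X z) w‖ := by
          conv_lhs => rw [hz]; rw [ContinuousLinearMap.adjoint_inner_right]
      _ ≤ ‖X z‖ * ‖w‖ := norm_inner_le_norm _ _
      _ ≤ (‖X ∘L Kᗮ.starProjection‖ * ‖z‖) * ‖v‖ := by
          rw [h2]
          exact mul_le_mul (ContinuousLinearMap.le_opNorm _ _) hwv (norm_nonneg _) (by positivity)
      _ = _ := by ring
  change ‖z‖ ≤ _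
  rcases (norm_nonneg z).eq_or_lt with h0 | h0
  · rw [← h0]; positivity
  · exact le_of_mul_le_mul_left h1 h0

/-- Since X⁺ X⁻ = 0, ‖X v‖² = ‖X⁺ v‖² + ‖X⁻ v‖²; both parts are dominated by X pointwise in norm and
so stay in the ideal. -/
theorem exists_pos_sub_pos {g : Weight} {X : H →L[ℂ] H} (hX : X ∈ LIdeal H g)
    (hsa : IsSelfAdjoint X) : ∃ A B : LIdeal H g, (A : H →L[ℂ] H).IsPositive ∧
      (B : H →L[ℂ] H).IsPositive ∧ X = A - B := by
  have hpos : (X⁺).IsPositive :=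
    (ContinuousLinearMap.nonneg_iff_isPositive _).mp (CFC.posPart_nonneg X)
  have hneg : (X⁻).IsPositive :=
    (ContinuousLinearMap.nonneg_iff_isPositive _).mp (CFC.negPart_nonneg X)
  have hsub : X⁺ - X⁻ = X := CFC.posPart_sub_negPart X hsa
  have horth : ∀ v, inner ℂ (X⁺ v) (X⁻ v) = 0 := by
    intro v
    rw [hpos.inner_left_eq_inner_right]
    have : X⁺ * X⁻ = 0 := CFC.posPart_mul_negPart X
    have h := congrArg (fun Z : H →L[ℂ] H => Z v) this
    have h' : X⁺ (X⁻ v) = 0 := h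
    rw [h', inner_zero_right]
  have hnorm : ∀ v, ‖X v‖ * ‖X v‖ = ‖X⁺ v‖ * ‖X⁺ v‖ + ‖X⁻ v‖ * ‖X⁻ v‖ := by
    intro v
    have h := norm_sub_sq (𝕜 := ℂ) (X⁺ v) (X⁻ v)
    rw [horth v] at h
    have h2 : X v = X⁺ v - X⁻ v := by
      conv_lhs => rw [← hsub]
      rfl
    rw [h2]
    simp only [map_zero, mul_zero, sub_zero] at h
    nlinarith
  refine ⟨⟨X⁺, LIdeal.mem_of_mu_le hX fun t ht => mu_le_mu_of_norm_le ht.le fun v => ?_⟩,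
    ⟨X⁻, LIdeal.mem_of_mu_le hX fun t ht => mu_le_mu_of_norm_le ht.le fun v => ?_⟩,
    hpos, hneg, hsub.symm⟩
  · exact (abs_le_of_sq_le_sq' (by nlinarith [hnorm v, mul_self_nonneg ‖X⁻ v‖]) (norm_nonneg _)).2
  · exact (abs_le_of_sq_le_sq' (by nlinarith [hnorm v, mul_self_nonneg ‖X⁺ v‖]) (norm_nonneg _)).2

/-- `X = (A - B) + i (C - D)` with `A, B, C, D` positive. -/
def IsPosDecomp {g : Weight} (X A B C D : LIdeal H g) : Prop :=
  (A : H →L[ℂ] H).IsPositive ∧ (B : H →L[ℂ] H).IsPositive ∧ (C : H →L[ℂ] H).IsPositive ∧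
    (D : H →L[ℂ] H).IsPositive ∧ X = (A - B) + Complex.I • (C - D)

theorem exists_isPosDecomp {g : Weight} (X : LIdeal H g) :
    ∃ A B C D, IsPosDecomp X A B C D := by
  have hadj : star (X : H →L[ℂ] H) ∈ LIdeal H g :=
    LIdeal.mem_of_mu_le X.2 fun t ht => mu_adjoint_le ht.le _
  have hre : (realPart (X : H →L[ℂ] H) : H →L[ℂ] H) ∈ LIdeal H g := by
    rw [realPart_apply_coe]
    exact Submodule.smul_of_tower_mem _ _ (add_mem X.2 hadj)
  have him : (imaginaryPart (X : H →L[ℂ] H) : H →L[ℂ] H) ∈ LIdeal H g := by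
    rw [imaginaryPart_apply_coe]
    exact Submodule.smul_mem _ _ (Submodule.smul_of_tower_mem _ _ (sub_mem X.2 hadj))
  obtain ⟨A, B, hA, hB, hAB⟩ := exists_pos_sub_pos hre (realPart (X : H →L[ℂ] H)).2
  obtain ⟨C, D, hC, hD, hCD⟩ := exists_pos_sub_pos him (imaginaryPart (X : H →L[ℂ] H)).2
  refine ⟨A, B, C, D, hA, hB, hC, hD, Subtype.ext ?_⟩
  have h := realPart_add_I_smul_imaginaryPart (X : H →L[ℂ] H)
  rw [hAB, hCD] at h
  exact h.symm

theorem linearMap_ext_of_isPositive {g : Weight} {φ ψ : LIdeal H g →ₗ[ℂ] ℂ}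
    (h : ∀ X : LIdeal H g, (X : H →L[ℂ] H).IsPositive → φ X = ψ X) : φ = ψ := by
  ext X
  obtain ⟨A, B, C, D, hA, hB, hC, hD, rfl⟩ := exists_isPosDecomp X
  simp only [map_add, map_sub, map_smul, h A hA, h B hB, h C hC, h D hD]

/-- The difference of two decompositions reads S = i T with S and T self-adjoint, so both vanish.
Moving negative terms across leaves equalities between sums of positive operators, to which
additivity applies. -/
theorem IsPosDecomp.value_unique {g : Weight} {p : LIdeal H g → ℂ}
    (hadd : ∀ X Y : LIdeal H g, (X : H →L[ℂ] H).IsPositive → (Y : H →L[ℂ] H).IsPositive →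
      p (X + Y) = p X + p Y) {X A B C D A' B' C' D' : LIdeal H g} (h : IsPosDecomp X A B C D)
    (h' : IsPosDecomp X A' B' C' D') :
    p A - p B + Complex.I * (p C - p D) = p A' - p B' + Complex.I * (p C' - p D') := by
  obtain ⟨hA, hB, hC, hD, hX⟩ := h
  obtain ⟨hA', hB', hC', hD', hX'⟩ := h'
  set S : H →L[ℂ] H := ((A : H →L[ℂ] H) - B) - (A' - B') with hS
  set T : H →L[ℂ] H := ((C' : H →L[ℂ] H) - D') - (C - D) with hT
  have hSsa : star S = S :=
    ((hA.isSelfAdjoint.sub hB.isSelfAdjoint).sub (hA'.isSelfAdjoint.sub hB'.isSelfAdjoint)).star_eq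
  have hTsa : star T = T :=
    ((hC'.isSelfAdjoint.sub hD'.isSelfAdjoint).sub (hC.isSelfAdjoint.sub hD.isSelfAdjoint)).star_eq
  have hST : S = Complex.I • T := by
    have h1 : ((A : H →L[ℂ] H) - B) + Complex.I • ((C : H →L[ℂ] H) - D) =
        ((A' : H →L[ℂ] H) - B') + Complex.I • ((C' : H →L[ℂ] H) - D') :=
      congrArg Subtype.val (hX.symm.trans hX')
    rw [hS, hT, smul_sub, sub_eq_sub_iff_add_eq_add, h1, add_comm]
  have hST' : S = -(Complex.I • T) := by
    have h1 := congrArg star hST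
    rw [hSsa, star_smul, hTsa] at h1
    simpa using h1
  have hS0 : S = 0 := by
    have h2 : S + S = 0 := by
      nth_rewrite 1 [hST]
      rw [hST', add_neg_cancel]
    rw [← two_smul ℂ S] at h2
    exact (smul_eq_zero.mp h2).resolve_left two_ne_zero
  have hT0 : T = 0 := by
    rw [hS0] at hST
    exact (smul_eq_zero.mp hST.symm).resolve_left Complex.I_ne_zero
  have e1 : A + B' = A' + B := by
    apply Subtype.ext
    have : (A : H →L[ℂ] H) - B = A' - B' := sub_eq_zero.mp hS0
    exact sub_eq_sub_iff_add_eq_add.mp this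
  have e2 : C' + D = C + D' := by
    apply Subtype.ext
    have : (C' : H →L[ℂ] H) - D' = C - D := sub_eq_zero.mp hT0
    exact sub_eq_sub_iff_add_eq_add.mp this
  have e1' := congrArg p e1
  have e2' := congrArg p e2
  rw [hadd _ _ hA hB', hadd _ _ hA' hB] at e1'
  rw [hadd _ _ hC' hD, hadd _ _ hC hD'] at e2'
  linear_combination e1' - Complex.I * e2'

/-- An additive, positively homogeneous function on the positive cone of `L_g(H)` extends to a
linear functional. -/
theorem exists_linearMap_of_additive {g : Weight} (p : LIdeal H g → ℂ)
    (hadd : ∀ X Y : LIdeal H g, (X : H →L[ℂ] H).IsPositive → (Y : H →L[ℂ] H).IsPositive →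
      p (X + Y) = p X + p Y)
    (hsmul : ∀ (c : ℝ) (X : LIdeal H g), 0 ≤ c → (X : H →L[ℂ] H).IsPositive →
      p ((c : ℂ) • X) = c * p X) :
    ∃ φ : LIdeal H g →ₗ[ℂ] ℂ, ∀ X : LIdeal H g, (X : H →L[ℂ] H).IsPositive → φ X = p X := by
  choose A B C D hdec using exists_isPosDecomp (H := H) (g := g)
  let q : LIdeal H g → ℂ := fun X => p (A X) - p (B X) + Complex.I * (p (C X) - p (D X))
  -- The value of q may be computed from any decomposition, so each algebraic law below is checked
  -- on a convenient one.
  have hq : ∀ {X a b c d : LIdeal H g}, IsPosDecomp X a b c d →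
      q X = p a - p b + Complex.I * (p c - p d) := fun h => (hdec _).value_unique hadd h
  have hqadd : ∀ X Y, q (X + Y) = q X + q Y := by
    intro X Y
    obtain ⟨h1, h2, h3, h4, h5⟩ := hdec X
    obtain ⟨k1, k2, k3, k4, k5⟩ := hdec Y
    rw [hq (X := X + Y) (a := A X + A Y) (b := B X + B Y) (c := C X + C Y) (d := D X + D Y)
      ⟨h1.add k1, h2.add k2, h3.add k3, h4.add k4, ?_⟩, hadd _ _ h1 k1,
      hadd _ _ h2 k2, hadd _ _ h3 k3, hadd _ _ h4 k4]
    · simp only [q]; ring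
    · conv_lhs => rw [h5, k5]
      module
  have hqI : ∀ X, q (Complex.I • X) = Complex.I * q X := by
    intro X
    obtain ⟨h1, h2, h3, h4, h5⟩ := hdec X
    rw [hq (X := Complex.I • X) ⟨h4, h3, h1, h2, ?_⟩]
    · simp only [q]
      linear_combination (p (C X) - p (D X)) * (-Complex.I_mul_I)
    · conv_lhs => rw [h5]
      rw [smul_add, smul_smul, Complex.I_mul_I]
      module
  have hqneg : ∀ X, q (-X) = -q X := by
    intro X
    obtain ⟨h1, h2, h3, h4, h5⟩ := hdec X
    rw [hq (X := -X) ⟨h2, h1, h4, h3, ?_⟩]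
    · simp only [q]; ring
    · conv_lhs => rw [h5]
      module
  have hqpos : ∀ (r : ℝ) X, 0 ≤ r → q ((r : ℂ) • X) = r * q X := by
    intro r X hr
    obtain ⟨h1, h2, h3, h4, h5⟩ := hdec X
    have hr' : (0 : ℂ) ≤ r := by exact_mod_cast hr
    rw [hq (X := (r : ℂ) • X) (a := (r : ℂ) • A X) (b := (r : ℂ) • B X) (c := (r : ℂ) • C X)
      (d := (r : ℂ) • D X) ⟨h1.smul_of_nonneg hr', h2.smul_of_nonneg hr', h3.smul_of_nonneg hr',
      h4.smul_of_nonneg hr', ?_⟩, hsmul _ _ hr h1, hsmul _ _ hr h2, hsmul _ _ hr h3,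
      hsmul _ _ hr h4]
    · simp only [q]; ring
    · conv_lhs => rw [h5]
      rw [smul_add, smul_comm (r : ℂ) Complex.I]
      module
  have hqreal : ∀ (r : ℝ) X, q ((r : ℂ) • X) = r * q X := by
    intro r X
    rcases le_total 0 r with hr | hr
    · exact hqpos r X hr
    · have h1 : (r : ℂ) • X = -(((-r : ℝ) : ℂ) • X) := by push_cast; module
      rw [h1, hqneg, hqpos _ _ (by linarith)]
      push_cast
      ring
  refine ⟨{ toFun := q, map_add' := hqadd, map_smul' := fun c X => ?_ }, fun X hX => ?_⟩
  · have h1 : c • X = (c.re : ℂ) • X + Complex.I • ((c.im : ℂ) • X) := by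
      conv_lhs => rw [← Complex.re_add_im c]
      rw [add_smul, smul_smul, mul_comm Complex.I]
    rw [h1, hqadd, hqI, hqreal, hqreal, RingHom.id_apply, smul_eq_mul]
    conv_rhs => rw [← Complex.re_add_im c]
    ring
  · have h0 : p 0 = 0 := by
      have := hsmul 0 0 le_rfl ContinuousLinearMap.isPositive_zero
      simpa using this
    change q X = p X
    rw [hq (X := X) (a := X) (b := 0) (c := 0) (d := 0) ⟨hX, ContinuousLinearMap.isPositive_zero,
      ContinuousLinearMap.isPositive_zero, ContinuousLinearMap.isPositive_zero, by simp⟩, h0]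
    simp

end Cone

/-! ### Extended limits -/

section ExtendedLimits

/-- The bounded sequence with the given entries. -/
noncomputable def mkLinf (f : ℕ → ℂ) (C : ℝ) (h : ∀ n, ‖f n‖ ≤ C) : Linf :=
  ⟨f, memℓp_infty ⟨C, by rintro _ ⟨n, rfl⟩; exact h n⟩⟩

theorem Linf.norm_apply_le (x : Linf) (n : ℕ) : ‖x n‖ ≤ ‖x‖ :=
  lp.norm_apply_le_norm ENNReal.top_ne_zero x n

/-- The bounded operator on `ℓ_∞` with the given pointwise bounded components. -/
noncomputable def linfOp (T : Linf →ₗ[ℂ] (ℕ → ℂ)) (K : ℝ) (hK : 0 ≤ K)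
    (h : ∀ x n, ‖T x n‖ ≤ K * ‖x‖) : Linf →L[ℂ] Linf :=
  LinearMap.mkContinuous
    { toFun := fun x => mkLinf (T x) (K * ‖x‖) (h x)
      map_add' := fun x y => by ext n; exact congrFun (map_add T x y) n
      map_smul' := fun c x => by ext n; exact congrFun (map_smul T c x) n }
    K fun x => lp.norm_le_of_forall_le (by positivity) (h x)

/-- Composition of a bounded sequence with a reindexing. -/
noncomputable def linfComp (k : ℕ → ℕ) : Linf →L[ℂ] Linf :=
  linfOp { toFun := fun x n => x (k n), map_add' := fun _ _ => rfl, map_smul' := fun _ _ => rfl }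
    1 zero_le_one fun x n => (x.norm_apply_le (k n)).trans_eq (one_mul _).symm

theorem linfComp_apply (k : ℕ → ℕ) (x : Linf) (n : ℕ) : linfComp k x n = x (k n) := rfl

/-- The limit along a nonprincipal ultrafilter, which exists because bounded sequences stay in a
compact disc. -/
theorem exists_isExtendedLimit : ∃ ω : Linf →L[ℂ] ℂ, IsExtendedLimit ω := by
  have hU : (hyperfilter ℕ : Filter ℕ) ≤ atTop := by
    rw [← Nat.cofinite_eq_atTop]; exact hyperfilter_le_cofinite
  have hlim : ∀ x : Linf, ∃ a : ℂ, ‖a‖ ≤ ‖x‖ ∧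
      Tendsto (fun n => x n) (hyperfilter ℕ : Filter ℕ) (𝓝 a) := by
    intro x
    obtain ⟨a, ha, hle⟩ := (isCompact_closedBall (0 : ℂ) ‖x‖).ultrafilter_le_nhds
      ((hyperfilter ℕ).map fun n => x n) (by
        rw [Ultrafilter.coe_map, le_principal_iff, mem_map]
        refine univ_mem' fun n => ?_
        simpa using x.norm_apply_le n)
    exact ⟨a, by simpa using ha, hle⟩
  choose L hLn hL using hlim
  refine ⟨LinearMap.mkContinuous { toFun := L, map_add' := ?_, map_smul' := ?_ } 1 ?_, ?_, ?_⟩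
  · exact fun x y => tendsto_nhds_unique (hL (x + y)) ((hL x).add (hL y))
  · exact fun c x => tendsto_nhds_unique (hL (c • x)) ((hL x).const_mul c)
  · exact fun x => by simpa using hLn x
  · exact fun x hx => ge_of_tendsto (hL x) (Eventually.of_forall hx)
  · exact fun x a ha => tendsto_nhds_unique (hL x) (ha.mono_left hU)

namespace IsExtendedLimit

variable {ω : Linf →L[ℂ] ℂ}

theorem congr (hω : IsExtendedLimit ω) {x y : Linf}
    (h : Tendsto (fun n => x n - y n) atTop (𝓝 0)) : ω x = ω y := by
  rw [← sub_eq_zero, ← map_sub]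
  exact hω.eq_lim _ _ h

theorem comp_linfComp (hω : IsExtendedLimit ω) {k : ℕ → ℕ} (hk : Tendsto k atTop atTop) :
    IsExtendedLimit (ω ∘L linfComp k) :=
  ⟨fun _ hx => hω.nonneg _ fun n => hx (k n), fun _ a ha => hω.eq_lim _ a (ha.comp hk)⟩

theorem convex_comb (hω : IsExtendedLimit ω) {ω' : Linf →L[ℂ] ℂ} (hω' : IsExtendedLimit ω')
    {s t : ℝ} (hs : 0 ≤ s) (ht : 0 ≤ t) (hst : s + t = 1) :
    IsExtendedLimit ((s : ℂ) • ω + (t : ℂ) • ω') := by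
  refine ⟨fun x hx => ?_, fun x a ha => ?_⟩
  · exact add_nonneg (mul_nonneg (by exact_mod_cast hs) (hω.nonneg x hx))
      (mul_nonneg (by exact_mod_cast ht) (hω'.nonneg x hx))
  · change (s : ℂ) * ω x + (t : ℂ) * ω' x = a
    rw [hω.eq_lim x a ha, hω'.eq_lim x a ha, ← add_mul, ← Complex.ofReal_add, hst]
    simp

theorem mono (hω : IsExtendedLimit ω) {x y : Linf} (h : ∀ n, x n ≤ y n) : ω x ≤ ω y := by
  rw [← sub_nonneg, ← map_sub]
  exact hω.nonneg _ fun n => sub_nonneg.mpr (h n)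

end IsExtendedLimit

end ExtendedLimits

/-! ### Dixmier traces on ideals with a slowly varying weight -/

section Traces

variable {H : Type*} [NormedAddCommGroup H] [InnerProductSpace ℂ H] [CompleteSpace H]

/-- The primitive `G(n) = ∫_0^n g`. -/
noncomputable def Weight.primitive (g : Weight) (n : ℕ) : ℝ := ∫ s in (0 : ℝ)..n, g s

/-- Weights which decrease on `[0, ∞)`, are `O(1/t)` and are not integrable. -/
structure Weight.IsSlow (g : Weight) : Prop where
  anti : AntitoneOn g (Ici 0)
  mul_le : ∃ B : ℝ, ∀ t, 0 < t → t * g t ≤ B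
  tendsto : Tendsto g.primitive atTop atTop

namespace Weight.IsSlow

variable {g : Weight}

/-- The comparison with the integral starts at 0; for this reason `IsSlow` includes monotonicity at
0, where a `Weight` is unconstrained. -/
theorem sum_le_primitive (hg : g.IsSlow) (n : ℕ) :
    ∑ k ∈ Finset.range n, g (k + 1 : ℕ) ≤ g.primitive n := by
  have h := AntitoneOn.sum_le_integral (x₀ := 0) (a := n) (hg.anti.mono Icc_subset_Ici_self)
  simpa only [zero_add, Weight.primitive] using h

theorem primitive_ge (hg : g.IsSlow) {n : ℕ} (hn : 1 ≤ n) : g 1 ≤ g.primitive n := by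
  refine le_trans ?_ (hg.sum_le_primitive n)
  have h := Finset.single_le_sum (f := fun k : ℕ => g (k + 1 : ℕ))
    (fun k _ => (g.pos _ (by positivity)).le) (Finset.mem_range.mpr hn)
  simpa using h

/-- This makes every bounded error in a sum of singular values invisible to extended limits. The
index 0 is excluded because the primitive vanishes there. -/
theorem tendsto_div_primitive (hg : g.IsSlow) {a : ℕ → ℝ} {C : ℝ}
    (ha : ∀ n, 1 ≤ n → |a n| ≤ C) :
    Tendsto (fun n => ((a n / g.primitive n : ℝ) : ℂ)) atTop (𝓝 0) := by
  rw [tendsto_zero_iff_norm_tendsto_zero]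
  refine squeeze_zero' (Eventually.of_forall fun _ => norm_nonneg _) ?_
    (hg.tendsto.const_div_atTop C)
  filter_upwards [eventually_ge_atTop 1] with n hn
  have hG : 0 < g.primitive n := (g.pos 1 one_pos).trans_le (hg.primitive_ge hn)
  rw [Complex.norm_real, Real.norm_eq_abs, abs_div, abs_of_pos hG]
  exact div_le_div_of_nonneg_right (ha n hn) hG.le

end Weight.IsSlow

/-! ### Dixmier averages and their asymptotic additivity -/

theorem LIdeal.exists_mu_le {g : Weight} (X : LIdeal H g) :
    ∃ C : ℝ, 0 ≤ C ∧ ∀ t, 0 < t → mu t (X : H →L[ℂ] H) ≤ C * g t := by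
  obtain ⟨C, hC⟩ := X.2
  have h : ∀ t, 0 < t → mu t (X : H →L[ℂ] H) ≤ C * g t := fun t ht =>
    (div_le_iff₀ (g.pos t ht)).mp (hC t ht)
  have h1 : 0 ≤ C * g 1 := (mu_nonneg _ _).trans (h 1 one_pos)
  exact ⟨C, nonneg_of_mul_nonneg_left h1 (g.pos 1 one_pos), h⟩

theorem sumMu_nonneg (N : ℕ) (X : H →L[ℂ] H) : 0 ≤ sumMu N X :=
  Finset.sum_nonneg fun _ _ => mu_nonneg _ _

theorem exists_sumMu_le {g : Weight} (hg : g.IsSlow) (X : LIdeal H g) :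
    ∃ C : ℝ, ∀ n : ℕ, sumMu (n + 1) (X : H →L[ℂ] H) / g.primitive n ≤ C := by
  obtain ⟨C, hC0, hC⟩ := LIdeal.exists_mu_le X
  have hg1 := g.pos 1 one_pos
  have hm := mu_nonneg 0 (X : H →L[ℂ] H)
  refine ⟨mu 0 (X : H →L[ℂ] H) / g 1 + C, fun n => ?_⟩
  rcases Nat.eq_zero_or_pos n with rfl | hn
  -- The entry at n = 0 is a division by 0, hence 0 in Lean, in accordance with the convention.
  · simp only [Weight.primitive, Nat.cast_zero, intervalIntegral.integral_same, div_zero]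
    positivity
  have hG := hg.primitive_ge hn
  rw [div_le_iff₀ (hg1.trans_le hG), sumMu, Finset.sum_range_succ', add_mul, add_comm,
    Nat.cast_zero]
  refine add_le_add ?_ ?_
  · rw [div_mul_eq_mul_div, le_div_iff₀ hg1]
    exact mul_le_mul_of_nonneg_left hG hm
  · refine le_trans ?_ (mul_le_mul_of_nonneg_left (hg.sum_le_primitive n) hC0)
    rw [Finset.mul_sum]
    exact Finset.sum_le_sum fun k _ => hC _ (by positivity)

/-- The averages `(∑_{k ≤ n} μ(k, X)) / G(n)`. -/
noncomputable def dixSeq {g : Weight} (hg : g.IsSlow) (X : LIdeal H g) : Linf :=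
  mkLinf (fun n => ((sumMu (n + 1) (X : H →L[ℂ] H) / g.primitive n : ℝ) : ℂ))
    (exists_sumMu_le hg X).choose fun n => by
      have hG : 0 ≤ g.primitive n := le_trans
        (Finset.sum_nonneg fun k _ => (g.pos _ (by positivity)).le) (hg.sum_le_primitive n)
      rw [Complex.norm_real, Real.norm_of_nonneg (div_nonneg (sumMu_nonneg _ _) hG)]
      exact (exists_sumMu_le hg X).choose_spec n

theorem dixSeq_apply {g : Weight} (hg : g.IsSlow) (X : LIdeal H g) (n : ℕ) :
    dixSeq hg X n = ((sumMu (n + 1) (X : H →L[ℂ] H) / g.primitive n : ℝ) : ℂ) := rfl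

theorem mu_smul {t : ℝ} (ht : 0 ≤ t) (c : ℂ) (X : H →L[ℂ] H) : mu t (c • X) = ‖c‖ * mu t X := by
  refine le_antisymm (mu_smul_le ht c X) ?_
  rcases eq_or_ne c 0 with rfl | hc
  · simp [mu_nonneg]
  · have h := mu_smul_le ht c⁻¹ (c • X)
    rw [smul_smul, inv_mul_cancel₀ hc, one_smul, norm_inv,
      le_inv_mul_iff₀ (norm_pos_iff.mpr hc)] at h
    exact h

theorem sumMu_smul (N : ℕ) {c : ℝ} (hc : 0 ≤ c) (X : H →L[ℂ] H) :
    sumMu N ((c : ℂ) • X) = c * sumMu N X := by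
  simp only [sumMu, mu_smul (Nat.cast_nonneg _), Complex.norm_real, Real.norm_of_nonneg hc,
    Finset.mul_sum]

/-- The N additional singular values are each at most μ(N) ≤ C g(N), and N g(N) is bounded. -/
theorem sumMu_two_mul_le {g : Weight} (hg : g.IsSlow) (X : LIdeal H g) :
    ∃ C : ℝ, ∀ N : ℕ, 1 ≤ N →
      sumMu (2 * N) (X : H →L[ℂ] H) ≤ sumMu N (X : H →L[ℂ] H) + C := by
  obtain ⟨C, hC0, hC⟩ := LIdeal.exists_mu_le X
  obtain ⟨B, hB⟩ := hg.mul_le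
  refine ⟨C * B, fun N hN => ?_⟩
  have hN0 : (0 : ℝ) < N := by exact_mod_cast hN
  rw [two_mul, sumMu, Finset.sum_range_add, ← sumMu]
  gcongr
  calc ∑ i ∈ Finset.range N, mu ((N + i : ℕ) : ℝ) (X : H →L[ℂ] H)
      ≤ ∑ i ∈ Finset.range N, mu (N : ℝ) (X : H →L[ℂ] H) :=
        Finset.sum_le_sum fun i _ =>
          mu_anti hN0.le (by push_cast; linarith [i.cast_nonneg (α := ℝ)]) _
    _ = N * mu (N : ℝ) (X : H →L[ℂ] H) := by simp
    _ ≤ N * (C * g N) := mul_le_mul_of_nonneg_left (hC _ hN0) hN0.le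
    _ = C * (N * g N) := by ring
    _ ≤ C * B := mul_le_mul_of_nonneg_left (hB _ hN0) hC0

/-- The bounded additivity defect of the sums of singular values on the positive cone. -/
theorem sumMu_add_defect {g : Weight} (hH : ¬ FiniteDimensional ℂ H) (hg : g.IsSlow)
    {X Y : LIdeal H g} (hX : (X : H →L[ℂ] H).IsPositive) (hY : (Y : H →L[ℂ] H).IsPositive) :
    ∃ C : ℝ, ∀ N : ℕ, 1 ≤ N → |sumMu N ((X + Y : LIdeal H g) : H →L[ℂ] H) -
      (sumMu N (X : H →L[ℂ] H) + sumMu N (Y : H →L[ℂ] H))| ≤ C := by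
  obtain ⟨C, hC⟩ := sumMu_two_mul_le hg (X + Y)
  refine ⟨C, fun N hN => ?_⟩
  have h1 := sumMu_add_le hH hX hY N
  have h2 := sumMu_add_sumMu_le hH hX hY N
  have h3 := hC N hN
  rw [Submodule.coe_add] at h3 ⊢
  rw [abs_le]
  constructor <;> linarith

/-- For a slow weight every extended limit defines a linear functional by the Dixmier formula. -/
theorem exists_dixmier_functional {g : Weight} (hH : ¬ FiniteDimensional ℂ H) (hg : g.IsSlow)
    {ω : Linf →L[ℂ] ℂ} (hω : IsExtendedLimit ω) :
    ∃ φ : LIdeal H g →ₗ[ℂ] ℂ, ∀ X : LIdeal H g, (X : H →L[ℂ] H).IsPositive →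
      φ X = (Real.log 2 : ℂ) * ω (dixSeq hg X) := by
  apply exists_linearMap_of_additive
  · intro X Y hX hY
    rw [← mul_add, ← map_add]
    congr 1
    apply hω.congr
    obtain ⟨C, hC⟩ := sumMu_add_defect hH hg hX hY
    refine (hg.tendsto_div_primitive fun n _ => hC (n + 1) (by omega)).congr fun n => ?_
    rw [lp.coeFn_add, Pi.add_apply, dixSeq_apply, dixSeq_apply, dixSeq_apply]
    push_cast
    ring
  · intro c X hc hX
    rw [mul_left_comm, ← smul_eq_mul (c : ℂ), ← map_smul]
    congr 2
    ext n
    rw [lp.coeFn_smul, Pi.smul_apply, dixSeq_apply, dixSeq_apply, Submodule.coe_smul,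
      sumMu_smul _ hc, smul_eq_mul]
    push_cast
    ring

/-- Symmetry is automatic, since the formula depends on X only through its singular values. -/
theorem isDixmierTrace_iff {g : Weight} (hg : g.IsSlow) (φ : LIdeal H g →ₗ[ℂ] ℂ) :
    IsDixmierTrace φ ↔ ∃ ω : Linf →L[ℂ] ℂ, IsExtendedLimit ω ∧
      ∀ X : LIdeal H g, (X : H →L[ℂ] H).IsPositive →
        φ X = (Real.log 2 : ℂ) * ω (dixSeq hg X) := by
  constructor
  · rintro ⟨-, ω, hω, h⟩
    refine ⟨ω, hω, fun X hX => ?_⟩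
    obtain ⟨hb, hφ⟩ := h X hX
    exact hφ
  · rintro ⟨ω, hω, h⟩
    refine ⟨fun X Y hX hY hXY => ?_, ω, hω, fun X hX => ⟨(dixSeq hg X).2, h X hX⟩⟩
    rw [h X hX, h Y hY]
    congr 2
    ext n
    rw [dixSeq_apply, dixSeq_apply]
    have hk : ∀ k : ℕ, mu (k : ℝ) (X : H →L[ℂ] H) = mu (k : ℝ) (Y : H →L[ℂ] H) := by
      intro k
      -- The hypothesis compares μ at positive arguments only; sampling at k + 1/2 also recovers
      -- μ(0).
      have hpos : (0 : ℝ) < k + 1 / 2 := by positivity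
      have hfl : ⌊(k : ℝ) + 1 / 2⌋₊ = k := by
        rw [Nat.floor_eq_iff hpos.le]
        constructor <;> linarith
      have h1 := hXY _ hpos
      rwa [mu_eq_mu_floor hpos.le, mu_eq_mu_floor hpos.le (Y : H →L[ℂ] H), hfl] at h1
    simp only [sumMu, hk]

/-! ### The values on `𝒟_g x` -/

theorem sum_range_two_pow {M : Type*} [AddCommMonoid M] (c : ℕ → M) (m : ℕ) :
    ∑ k ∈ Finset.range (2 ^ m), (if k = 0 then 0 else c (Nat.log 2 k)) =
      ∑ j ∈ Finset.range m, 2 ^ j • c j := by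
  induction m with
  | zero => simp
  | succ m ih =>
    rw [pow_succ, mul_two, Finset.sum_range_add, ih, Finset.sum_range_succ]
    congr 1
    have : ∀ i ∈ Finset.range (2 ^ m),
        (if 2 ^ m + i = 0 then 0 else c (Nat.log 2 (2 ^ m + i))) = c m := by
      intro i hi
      rw [Finset.mem_range] at hi
      have hp : 0 < 2 ^ m := by positivity
      have hlog : Nat.log 2 (2 ^ m + i) = m :=
        (Nat.log_eq_iff (Or.inr ⟨one_lt_two, by omega⟩)).mpr ⟨by omega, by rw [pow_succ]; omega⟩
      rw [if_neg (by omega), hlog]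
    rw [Finset.sum_congr rfl this, Finset.sum_const, Finset.card_range]

/-- The entries d_k need not decrease. They still satisfy d_k ≤ ‖x‖ g((n+1)/2) for k > n, so S(n+1)
exceeds the sum of the first n + 1 entries by at most 2B‖x‖. Rounding to whole dyadic blocks costs
at most one block, of mass at most B‖x‖. -/
theorem sumMu_calD_sub_le {g : Weight} (hg : g.IsSlow) {e : ℕ → H} (he : Orthonormal ℂ e)
    (hH : ¬ FiniteDimensional ℂ H) {x : Linf} {b : ℕ → ℝ} (hxb : ∀ n, x n = b n)
    (hb : ∀ n, 0 ≤ b n) :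
    ((calD g he x : LIdeal H g) : H →L[ℂ] H).IsPositive ∧
    ∃ C : ℝ, ∀ n : ℕ, 1 ≤ n → |sumMu (n + 1) (calD g he x : H →L[ℂ] H) -
      ∑ j ∈ Finset.range (Nat.log 2 n + 1), b j * (2 ^ j * g (2 ^ j))| ≤ C := by
  let d : ℕ → ℝ := fun k => if k = 0 then 0 else b (Nat.log 2 k) * g (2 ^ Nat.log 2 k)
  have hd : ∀ k, (⟨DSeq g x, DSeq_mem g x⟩ : Linf) k = d k := by
    intro k
    change DSeq g x k = _
    simp only [DSeq, d]
    split_ifs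
    · simp
    · rw [hxb]; push_cast; rfl
  have hd0 : ∀ k, 0 ≤ d k := by
    intro k
    simp only [d]
    split_ifs
    · exact le_rfl
    · exact mul_nonneg (hb _) (g.pos _ (by positivity)).le
  obtain ⟨B, hB⟩ := hg.mul_le
  have hpos : ((calD g he x : LIdeal H g) : H →L[ℂ] H).IsPositive := diagOp_isPositive he hd hd0
  refine ⟨hpos, 2 * B * ‖x‖, fun n hn => ?_⟩
  have hB0 : 0 ≤ B := le_trans (by simpa using (g.pos 1 one_pos).le) (hB 1 one_pos)
  have hBx : 0 ≤ B * ‖x‖ := mul_nonneg hB0 (norm_nonneg _)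
  have hlow := sum_le_sumMu_diagOp he hd hd0 (n + 1)
  have hn2 : (0 : ℝ) < (n + 1) / 2 := by positivity
  have hup := sumMu_diagOp_le he hH hd hd0 (n + 1) (n + 1) (c := ‖x‖ * g ((n + 1) / 2))
    (mul_nonneg (norm_nonneg _) (g.pos _ hn2).le) (by
      intro k hk
      have hk' : (n : ℝ) + 1 ≤ k := by exact_mod_cast hk
      have h := DSeq_norm_le g x (k := k) (t := n + 1) (by positivity) (by linarith)
      have h' : DSeq g x k = d k := hd k
      rwa [h', Complex.norm_real, Real.norm_of_nonneg (hd0 k)] at h)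
  have htail : ((n + 1 : ℕ) : ℝ) * (‖x‖ * g ((n + 1) / 2)) ≤ 2 * B * ‖x‖ := by
    have h := mul_le_mul_of_nonneg_right (hB _ hn2) (norm_nonneg x)
    push_cast
    linarith
  set m := Nat.log 2 n
  have hm1 : 2 ^ m ≤ n := Nat.pow_log_le_self 2 (by omega)
  have hm2 : n < 2 ^ (m + 1) := Nat.lt_pow_succ_log_self one_lt_two n
  have hblock : ∀ m, ∑ k ∈ Finset.range (2 ^ m), d k =
      ∑ j ∈ Finset.range m, b j * (2 ^ j * g (2 ^ j)) := by
    intro m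
    refine (sum_range_two_pow (fun j => b j * g (2 ^ j)) m).trans ?_
    refine Finset.sum_congr rfl fun j _ => ?_
    rw [nsmul_eq_mul]
    push_cast
    ring
  have h1 : ∑ k ∈ Finset.range (n + 1), d k ≤ ∑ k ∈ Finset.range (2 ^ (m + 1)), d k :=
    Finset.sum_le_sum_of_subset_of_nonneg (Finset.range_subset_range.mpr hm2)
      fun k _ _ => hd0 k
  have h2 : ∑ k ∈ Finset.range (2 ^ m), d k ≤ ∑ k ∈ Finset.range (n + 1), d k :=
    Finset.sum_le_sum_of_subset_of_nonneg (Finset.range_subset_range.mpr (by omega))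
      fun k _ _ => hd0 k
  rw [hblock] at h1 h2
  rw [Finset.sum_range_succ _ m] at h1
  have hbm : b m ≤ ‖x‖ := by
    have h := x.norm_apply_le m
    rwa [hxb, Complex.norm_real, Real.norm_of_nonneg (hb m)] at h
  have h3 : b m * (2 ^ m * g (2 ^ m)) ≤ B * ‖x‖ := by
    rw [mul_comm B]
    exact mul_le_mul hbm (hB _ (by positivity))
      (mul_nonneg (by positivity) (g.pos _ (by positivity)).le) (norm_nonneg _)
  change |sumMu (n + 1) (diagOp he ⟨DSeq g x, DSeq_mem g x⟩) - _| ≤ _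
  rw [Finset.sum_range_succ, abs_le]
  constructor <;> linarith

/-- The Dixmier formula on `𝒟_g x` involves only the partial sums of `x_j 2^j g(2^j)`. -/
theorem dixmier_calD {g : Weight} (hg : g.IsSlow) {e : ℕ → H} (he : Orthonormal ℂ e)
    (hH : ¬ FiniteDimensional ℂ H) {x : Linf} {b : ℕ → ℝ} (hxb : ∀ n, x n = b n)
    (hb : ∀ n, 0 ≤ b n) {ω : Linf →L[ℂ] ℂ} (hω : IsExtendedLimit ω) {y : Linf}
    (hy : Tendsto (fun n => (((∑ j ∈ Finset.range (Nat.log 2 n + 1), b j * (2 ^ j * g (2 ^ j))) /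
      g.primitive n : ℝ) : ℂ) - y n) atTop (𝓝 0)) :
    ω (dixSeq hg (calD g he x)) = ω y := by
  obtain ⟨-, C, hC⟩ := sumMu_calD_sub_le hg he hH hxb hb
  apply hω.congr
  have h := (hg.tendsto_div_primitive hC).add hy
  rw [add_zero] at h
  refine h.congr fun n => ?_
  rw [dixSeq_apply]
  push_cast
  ring

end Traces

/-! ### The two weights -/

section Weights

theorem fW_apply_of_lt {t : ℝ} (ht : t < 1) : fW t = 1 := if_pos ht

theorem fW_apply_of_le {t : ℝ} (ht : 1 ≤ t) : fW t = 1 / t := if_neg (not_lt.mpr ht)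

theorem gW_apply_of_lt {t : ℝ} (ht : t < 2) : gW t = 1 / 2 := if_pos ht

theorem gW_apply_of_le {t : ℝ} (ht : 2 ≤ t) : gW t = 1 / (t * Real.logb 2 t) :=
  if_neg (not_lt.mpr ht)

theorem fW_antitoneOn : AntitoneOn fW (Ici 0) := by
  intro s hs t ht hst
  rcases (show (0 : ℝ) ≤ s from hs).eq_or_lt with rfl | hs0
  · rw [fW_apply_of_lt zero_lt_one]
    rcases lt_or_ge t 1 with h | h
    · rw [fW_apply_of_lt h]
    · rw [fW_apply_of_le h, div_le_one (by linarith)]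
      exact h
  · exact fW.anti hs0 (hs0.trans_le hst) hst

theorem gW_antitoneOn : AntitoneOn gW (Ici 0) := by
  intro s hs t ht hst
  rcases (show (0 : ℝ) ≤ s from hs).eq_or_lt with rfl | hs0
  · rw [gW_apply_of_lt zero_lt_two]
    rcases lt_or_ge t 2 with h | h
    · rw [gW_apply_of_lt h]
    · have := logb_two_ge_one h
      rw [gW_apply_of_le h]
      apply one_div_le_one_div_of_le two_pos
      nlinarith
  · exact gW.anti hs0 (hs0.trans_le hst) hst

theorem AntitoneOn.intervalIntegrable_of_nonneg {u : ℝ → ℝ} (hu : AntitoneOn u (Ici 0)) {a b : ℝ}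
    (ha : 0 ≤ a) (hb : 0 ≤ b) : IntervalIntegrable u MeasureTheory.volume a b :=
  (hu.mono fun _ hx => (le_min ha hb).trans hx.1).intervalIntegrable

theorem fW_primitive {n : ℕ} (hn : 1 ≤ n) : fW.primitive n = 1 + Real.log n := by
  have hn' : (1 : ℝ) ≤ n := by exact_mod_cast hn
  have h1 : ∫ s in (0 : ℝ)..1, fW s = 1 := by
    rw [intervalIntegral.integral_congr (g := fun _ => (1 : ℝ))]
    · simp
    · intro s hs
      rw [uIcc_of_le zero_le_one] at hs
      rcases hs.2.eq_or_lt with rfl | h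
      · simp [fW_apply_of_le le_rfl]
      · exact fW_apply_of_lt h
  have h2 : ∫ s in (1 : ℝ)..n, fW s = Real.log n := by
    rw [intervalIntegral.integral_congr (g := fun s => 1 / s)]
    · rw [integral_one_div_of_pos one_pos (by linarith), div_one]
    · intro s hs
      rw [uIcc_of_le hn'] at hs
      exact fW_apply_of_le hs.1
  rw [Weight.primitive, ← intervalIntegral.integral_add_adjacent_intervals (b := 1)
    (fW_antitoneOn.intervalIntegrable_of_nonneg le_rfl zero_le_one)
    (fW_antitoneOn.intervalIntegrable_of_nonneg zero_le_one (by linarith)), h1, h2]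

/-- On [2, ∞) an antiderivative of g is log 2 · log log₂; the interval [0, 2] contributes the 1. -/
theorem gW_primitive {n : ℕ} (hn : 2 ≤ n) :
    gW.primitive n = 1 + Real.log 2 * Real.log (Real.logb 2 n) := by
  have hn' : (2 : ℝ) ≤ n := by exact_mod_cast hn
  have hl2 : 0 < Real.log 2 := Real.log_pos one_lt_two
  have h1 : ∫ s in (0 : ℝ)..2, gW s = 1 := by
    rw [intervalIntegral.integral_congr (g := fun _ => (1 / 2 : ℝ))]
    · simp
    · intro s hs
      rw [uIcc_of_le zero_le_two] at hs
      rcases hs.2.eq_or_lt with rfl | h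
      · simp [gW_apply_of_le le_rfl]
      · exact gW_apply_of_lt h
  have hint : IntervalIntegrable gW MeasureTheory.volume 2 n :=
    gW_antitoneOn.intervalIntegrable_of_nonneg zero_le_two (by linarith)
  have h2 : ∫ s in (2 : ℝ)..n, gW s = Real.log 2 * Real.log (Real.logb 2 n) := by
    rw [intervalIntegral.integral_eq_sub_of_hasDerivAt
      (f := fun s => Real.log 2 * Real.log (Real.logb 2 s)) _ hint]
    · simp
    · intro s hs
      rw [uIcc_of_le hn'] at hs
      have hs0 : (0 : ℝ) < s := by linarith [hs.1]
      have hlb := logb_two_ge_one hs.1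
      have hd : HasDerivAt (fun s => Real.logb 2 s) (s⁻¹ / Real.log 2) s :=
        (Real.hasDerivAt_log hs0.ne').div_const _
      have hd' := (hd.log (by linarith)).const_mul (Real.log 2)
      convert! hd' using 1
      rw [gW_apply_of_le hs.1]
      field_simp
  rw [Weight.primitive, ← intervalIntegral.integral_add_adjacent_intervals (b := 2)
    (gW_antitoneOn.intervalIntegrable_of_nonneg le_rfl zero_le_two) hint, h1, h2]

theorem fW_isSlow : fW.IsSlow := by
  refine ⟨fW_antitoneOn, ⟨1, fun t ht => ?_⟩, ?_⟩
  · rcases lt_or_ge t 1 with h | h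
    · rw [fW_apply_of_lt h]; linarith
    · rw [fW_apply_of_le h, mul_one_div_cancel ht.ne']
  · refine (tendsto_atTop_add_const_left _ 1
      (Real.tendsto_log_atTop.comp tendsto_natCast_atTop_atTop)).congr' ?_
    filter_upwards [eventually_ge_atTop 1] with n hn
    rw [fW_primitive hn]
    rfl

theorem gW_isSlow : gW.IsSlow := by
  refine ⟨gW_antitoneOn, ⟨1, fun t ht => ?_⟩, ?_⟩
  · rcases lt_or_ge t 2 with h | h
    · rw [gW_apply_of_lt h]; linarith
    · have := logb_two_ge_one h
      rw [gW_apply_of_le h, mul_one_div, div_le_one (by positivity)]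
      nlinarith
  · have h : Tendsto (fun n : ℕ => Real.log (Real.logb 2 n)) atTop atTop :=
      Real.tendsto_log_atTop.comp
        ((Real.tendsto_logb_atTop one_lt_two).comp tendsto_natCast_atTop_atTop)
    refine (tendsto_atTop_add_const_left _ 1
      (h.const_mul_atTop (Real.log_pos one_lt_two))).congr' ?_
    filter_upwards [eventually_ge_atTop 2] with n hn
    rw [gW_primitive hn]

theorem two_pow_mul_fW (j : ℕ) : (2 : ℝ) ^ j * fW (2 ^ j) = 1 := by
  rw [fW_apply_of_le (one_le_pow₀ one_le_two), mul_one_div_cancel (by positivity)]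

theorem two_pow_mul_gW (j : ℕ) : (2 : ℝ) ^ (j + 1) * gW (2 ^ (j + 1)) = 1 / (j + 1) := by
  have h2 : (2 : ℝ) ≤ 2 ^ (j + 1) := by
    rw [pow_succ]; linarith [one_le_pow₀ (one_le_two (α := ℝ)) (n := j)]
  rw [gW_apply_of_le h2, Real.logb_pow, Real.logb_self_eq_one one_lt_two]
  push_cast
  field_simp

theorem Weight.IsSlow.tendsto_complex_div_primitive {g : Weight} (hg : g.IsSlow) {a : ℕ → ℂ}
    {C : ℝ} (ha : ∀ n, 1 ≤ n → ‖a n‖ ≤ C) :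
    Tendsto (fun n => a n / (g.primitive n : ℂ)) atTop (𝓝 0) := by
  have h := hg.tendsto_div_primitive (a := fun n => ‖a n‖) (C := C) (by simpa using ha)
  rw [tendsto_zero_iff_norm_tendsto_zero] at h ⊢
  refine h.congr fun n => ?_
  rw [Complex.norm_real, norm_div, norm_div, norm_norm, Complex.norm_real]

end Weights

/-! ### Logarithmic means -/

section LogMean

/-- The partial sums of the harmonic series. -/
noncomputable def harm (m : ℕ) : ℝ := ∑ j ∈ Finset.range m, 1 / ((j : ℝ) + 1)

theorem harm_eq (m : ℕ) : harm m = (harmonic m : ℝ) := by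
  simp [harm, harmonic]

theorem gW_primitive_nonneg (n : ℕ) : 0 ≤ gW.primitive n :=
  le_trans (Finset.sum_nonneg fun _ _ => (gW.pos _ (by positivity)).le)
    (gW_isSlow.sum_le_primitive n)

/-- With m = ⌊log₂ n⌋, the estimates log(m+1) ≤ harm m ≤ 1 + log m enclose log log₂ n up to a
constant. The error log 2 is absorbed by the 1 in G, so the upper bound has no extra constant and
`logMean` has norm at most 1. -/
theorem log_two_mul_harm_bounds {n : ℕ} (hn : 2 ≤ n) :
    gW.primitive n - 1 ≤ Real.log 2 * harm (Nat.log 2 n) ∧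
      Real.log 2 * harm (Nat.log 2 n) ≤ gW.primitive n := by
  set m := Nat.log 2 n with hm
  have hl2 : 0 < Real.log 2 := Real.log_pos one_lt_two
  have hl2' : Real.log 2 ≤ 1 := by
    have := Real.log_le_sub_one_of_pos (zero_lt_two (α := ℝ)); linarith
  have hn0 : (0 : ℝ) < n := by positivity
  have hm1 : 1 ≤ m := Nat.log_pos one_lt_two hn
  have hm1' : (1 : ℝ) ≤ m := by exact_mod_cast hm1
  have h1 : (m : ℝ) ≤ Real.logb 2 n := by
    rw [Real.le_logb_iff_rpow_le one_lt_two hn0, Real.rpow_natCast]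
    exact_mod_cast Nat.pow_log_le_self 2 (by omega)
  have h2 : Real.logb 2 n ≤ (m + 1 : ℕ) := by
    rw [Real.logb_le_iff_le_rpow one_lt_two hn0, Real.rpow_natCast]
    exact_mod_cast (Nat.lt_pow_succ_log_self one_lt_two n).le
  have h3 : Real.log (m + 1 : ℕ) ≤ harm m := harm_eq m ▸ log_add_one_le_harmonic m
  have h4 : harm m ≤ 1 + Real.log m := harm_eq m ▸ harmonic_le_one_add_log m
  have h5 := Real.log_le_log (by linarith) h1
  have h6 := Real.log_le_log (by linarith) h2
  rw [gW_primitive hn]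
  constructor <;> nlinarith

theorem log_two_mul_harm_le (n : ℕ) : Real.log 2 * harm (Nat.log 2 n) ≤ gW.primitive n := by
  rcases lt_or_ge n 2 with h | h
  · rw [Nat.log_of_lt h]
    simpa [harm] using gW_primitive_nonneg n
  · exact (log_two_mul_harm_bounds h).2

/-- The partial sums `∑_{1 ≤ j ≤ m} x_j / j`. -/
noncomputable def logSum (x : ℕ → ℂ) (m : ℕ) : ℂ :=
  ∑ j ∈ Finset.range m, x (j + 1) / ((j : ℂ) + 1)

theorem logSum_norm_le {x : ℕ → ℂ} {C : ℝ} (hx : ∀ n, ‖x n‖ ≤ C) (m : ℕ) :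
    ‖logSum x m‖ ≤ C * harm m := by
  rw [logSum, harm, Finset.mul_sum]
  refine norm_sum_le_of_le _ fun j _ => ?_
  have : ‖((j : ℂ) + 1)‖ = (j : ℝ) + 1 := by
    have := Complex.norm_natCast (j + 1)
    push_cast at this
    exact this
  rw [norm_div, this, mul_one_div]
  exact div_le_div_of_nonneg_right (hx _) (by positivity)

/-- The logarithmic means of a bounded sequence, evaluated along `⌊log₂ n⌋` and normalised by the
primitive of `g`. -/
noncomputable def logMean : Linf →L[ℂ] Linf :=
  linfOp
    { toFun := fun x n => ((Real.log 2 : ℝ) : ℂ) * logSum x (Nat.log 2 n) / (gW.primitive n : ℂ)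
      map_add' := fun x y => by
        ext n
        simp only [logSum, lp.coeFn_add, Pi.add_apply, add_div, mul_add, Finset.sum_add_distrib]
      map_smul' := fun c x => by
        ext n
        simp only [logSum, lp.coeFn_smul, Pi.smul_apply, smul_eq_mul, RingHom.id_apply,
          mul_div_assoc, ← Finset.mul_sum]
        ring }
    1 zero_le_one fun x n => by
      change ‖((Real.log 2 : ℝ) : ℂ) * logSum x (Nat.log 2 n) / (gW.primitive n : ℂ)‖ ≤ _
      have hl2 : 0 < Real.log 2 := Real.log_pos one_lt_two
      rw [norm_div, norm_mul, Complex.norm_real, Complex.norm_real, Real.norm_of_nonneg hl2.le,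
        Real.norm_of_nonneg (gW_primitive_nonneg n), one_mul]
      refine div_le_of_le_mul₀ (gW_primitive_nonneg n) (norm_nonneg x) ?_
      calc Real.log 2 * ‖logSum x (Nat.log 2 n)‖ ≤ Real.log 2 * (‖x‖ * harm (Nat.log 2 n)) :=
            mul_le_mul_of_nonneg_left (logSum_norm_le x.norm_apply_le _) hl2.le
        _ = ‖x‖ * (Real.log 2 * harm (Nat.log 2 n)) := by ring
        _ ≤ ‖x‖ * gW.primitive n :=
            mul_le_mul_of_nonneg_left (log_two_mul_harm_le n) (norm_nonneg x)

theorem logMean_apply (x : Linf) (n : ℕ) : logMean x n =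
    ((Real.log 2 : ℝ) : ℂ) * logSum x (Nat.log 2 n) / (gW.primitive n : ℂ) := rfl

theorem tendsto_natLog_two : Tendsto (Nat.log 2) atTop atTop :=
  tendsto_atTop_atTop.mpr fun b => ⟨2 ^ b, fun n hn => by
    have := Nat.log_mono_right (b := 2) hn
    rwa [Nat.log_pow one_lt_two] at this⟩

theorem tendsto_log_two_mul_harm :
    Tendsto (fun n => ((Real.log 2 * harm (Nat.log 2 n) / gW.primitive n : ℝ) : ℂ)) atTop
      (𝓝 1) := by
  have h := gW_isSlow.tendsto_div_primitive
    (a := fun n => Real.log 2 * harm (Nat.log 2 n) - gW.primitive n)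
    (C := max 1 (gW.primitive 1)) (by
      intro n hn
      rcases hn.eq_or_lt with rfl | hn
      · simp [harm, abs_of_nonneg (gW_primitive_nonneg 1)]
      · obtain ⟨h1, h2⟩ := log_two_mul_harm_bounds hn
        refine le_trans ?_ (le_max_left _ _)
        rw [abs_le]
        constructor <;> linarith)
  rw [← tendsto_sub_nhds_zero_iff]
  refine h.congr' ?_
  filter_upwards [eventually_ge_atTop 1] with n hn
  have hG : gW.primitive n ≠ 0 := ((gW.pos 1 one_pos).trans_le (gW_isSlow.primitive_ge hn)).ne'
  rw [sub_div, div_self hG]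
  push_cast
  rfl

/-- Toeplitz regularity: (x_{j+1} - a)/(j+1) = o(1/(j+1)), and the harmonic series diverges, so the
partial sums are o of the harmonic sums. -/
theorem logMean_tendsto {x : Linf} {a : ℂ} (hx : Tendsto (fun n => x n) atTop (𝓝 a)) :
    Tendsto (fun n => logMean x n) atTop (𝓝 a) := by
  have hlo : (fun j : ℕ => (x (j + 1) - a) / ((j : ℂ) + 1)) =o[atTop]
      fun j : ℕ => 1 / ((j : ℝ) + 1) := by
    have h0 : (fun j : ℕ => x (j + 1) - a) =o[atTop] fun _ => (1 : ℝ) := by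
      rw [Asymptotics.isLittleO_one_iff]
      exact tendsto_sub_nhds_zero_iff.mpr (hx.comp (tendsto_add_atTop_nat 1))
    have h1 : (fun j : ℕ => (1 : ℂ) / ((j : ℂ) + 1)) =O[atTop] fun j : ℕ => 1 / ((j : ℝ) + 1) := by
      refine Asymptotics.IsBigO.of_bound 1 (Eventually.of_forall fun j => ?_)
      have := Complex.norm_natCast (j + 1)
      push_cast at this
      rw [norm_div, this, norm_one, one_mul, Real.norm_of_nonneg (by positivity)]
    refine (h0.mul_isBigO h1).congr (fun j => by ring) (fun j => by ring)
  have hsum := (hlo.sum_range (fun j => by positivity)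
    Real.tendsto_sum_range_one_div_nat_succ_atTop).comp_tendsto tendsto_natLog_two
  have hz := (Complex.isLittleO_ofReal_right.mpr hsum).tendsto_div_nhds_zero
  have hfin := (hz.mul tendsto_log_two_mul_harm).add (tendsto_log_two_mul_harm.const_mul a)
  rw [zero_mul, mul_one, zero_add] at hfin
  refine hfin.congr' ?_
  filter_upwards [eventually_ge_atTop 2] with n hn
  have hh : harm (Nat.log 2 n) ≠ 0 := by
    have h1 : 0 < harm (Nat.log 2 n) := by
      refine Finset.sum_pos (fun j _ => by positivity) ?_
      rw [Finset.nonempty_range_iff]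
      exact (Nat.log_pos one_lt_two hn).ne'
    exact h1.ne'
  have e1 : ∑ j ∈ Finset.range (Nat.log 2 n), (x (j + 1) - a) / ((j : ℂ) + 1) =
      logSum x (Nat.log 2 n) - a * (harm (Nat.log 2 n) : ℂ) := by
    rw [logSum, harm, Complex.ofReal_sum, Finset.mul_sum, ← Finset.sum_sub_distrib]
    refine Finset.sum_congr rfl fun j _ => ?_
    push_cast
    ring
  have hh' : (harm (Nat.log 2 n) : ℂ) ≠ 0 := by exact_mod_cast hh
  change (∑ j ∈ Finset.range (Nat.log 2 n), (x (j + 1) - a) / ((j : ℂ) + 1)) /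
    ((harm (Nat.log 2 n) : ℝ) : ℂ) * _ + _ = _
  rw [e1, logMean_apply]
  push_cast
  field_simp
  ring

/-- Abel summation: the logarithmic means of `x` and of its Cesàro means are asymptotic. -/
theorem logMean_sub_tendsto_zero {x z : Linf} {A : ℕ → ℂ} (hA : ∀ j, A (j + 1) - A j = x j)
    (hz : Tendsto (fun j : ℕ => A (j + 1) / ((j : ℂ) + 1) - z j) atTop (𝓝 0)) :
    Tendsto (fun n => logMean x n - logMean z n) atTop (𝓝 0) := by
  have hAn : ∀ n : ℕ, ‖A n‖ ≤ ‖A 0‖ + n * ‖x‖ := by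
    intro n
    induction n with
    | zero => simp
    | succ n ih =>
      have h1 : A (n + 1) = A n + x n := by rw [← hA n]; ring
      rw [h1]
      refine (norm_add_le _ _).trans ?_
      push_cast
      linarith [x.norm_apply_le n]
  have hcast : ∀ j : ℕ, ‖((j : ℂ) + 1)‖ = (j : ℝ) + 1 := fun j => by
    have := Complex.norm_natCast (j + 1)
    push_cast at this
    exact this
  have hAb : ∀ n : ℕ, ‖A (n + 1) / ((n : ℂ) + 1)‖ ≤ ‖A 0‖ + ‖x‖ := by
    intro n
    have h := hAn (n + 1)
    rw [norm_div, hcast, div_le_iff₀ (by positivity)]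
    push_cast at h
    nlinarith [mul_nonneg (n.cast_nonneg (α := ℝ)) (norm_nonneg (A 0))]
  -- The null sequence r is the difference between the Cesàro means of x and z; its logarithmic
  -- means vanish in the limit by regularity.
  let r : Linf := mkLinf (fun j => A (j + 1) / ((j : ℂ) + 1) - z j) (‖A 0‖ + ‖x‖ + ‖z‖)
    fun j => (norm_sub_le _ _).trans (add_le_add (hAb j) (z.norm_apply_le j))
  have hr : Tendsto (fun n => logMean r n) atTop (𝓝 0) := logMean_tendsto hz
  have hb : ∀ n, 1 ≤ n → ‖((Real.log 2 : ℝ) : ℂ) * (A (Nat.log 2 n + 1) / ((Nat.log 2 n : ℕ) + 1)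
      - A 1)‖ ≤ Real.log 2 * (‖A 0‖ + ‖x‖ + (‖A 0‖ + ‖x‖)) := by
    intro n _
    have hl2 : 0 < Real.log 2 := Real.log_pos one_lt_two
    rw [norm_mul, Complex.norm_real, Real.norm_of_nonneg hl2.le]
    refine mul_le_mul_of_nonneg_left ((norm_sub_le _ _).trans (add_le_add (hAb _) ?_)) hl2.le
    simpa using hAb 0
  have h := hr.add (gW_isSlow.tendsto_complex_div_primitive hb)
  rw [add_zero] at h
  refine h.congr fun n => ?_
  -- Exact Abel summation, from 1/((m+1)(m+2)) = 1/(m+1) - 1/(m+2). The boundary term A(m+1)/(m+1) -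
  -- A(1) is bounded and dies after division by G.
  have hsum : ∀ m : ℕ, logSum r m + (A (m + 1) / ((m : ℂ) + 1) - A 1) =
      logSum x m - logSum z m := by
    intro m
    induction m with
    | zero => simp [logSum]
    | succ m ih =>
      have e : ∀ u : ℕ → ℂ, logSum u (m + 1) = logSum u m + u (m + 1) / ((m : ℂ) + 1) :=
        fun u => Finset.sum_range_succ _ _
      have hr' : r (m + 1) = A (m + 1 + 1) / (((m + 1 : ℕ) : ℂ) + 1) - z (m + 1) := rfl
      have h1 : (m : ℂ) + 1 ≠ 0 := by exact_mod_cast Nat.succ_ne_zero m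
      have h2 : (m : ℂ) + 1 + 1 ≠ 0 := by exact_mod_cast Nat.succ_ne_zero (m + 1)
      rw [e, e, e, hr', ← hA (m + 1)]
      have key : (A (m + 1 + 1) / ((m : ℂ) + 1 + 1) - z (m + 1)) / ((m : ℂ) + 1) +
          A (m + 1 + 1) / ((m : ℂ) + 1 + 1) - A (m + 1) / ((m : ℂ) + 1) =
          (A (m + 1 + 1) - A (m + 1)) / ((m : ℂ) + 1) - z (m + 1) / ((m : ℂ) + 1) := by
        field_simp
        ring
      push_cast
      linear_combination ih + key
  rw [logMean_apply, logMean_apply, logMean_apply, ← add_div, ← mul_add, hsum, ← sub_div, mul_sub]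

/-- On `𝒟_g x` with `x ≥ 0`, a Dixmier trace is an extended limit of logarithmic means. -/
theorem dixmier_calD_gW {H : Type*} [NormedAddCommGroup H] [InnerProductSpace ℂ H]
    [CompleteSpace H] {e : ℕ → H} (he : Orthonormal ℂ e) (hH : ¬ FiniteDimensional ℂ H) {x : Linf}
    {b : ℕ → ℝ} (hxb : ∀ n, x n = b n) (hb : ∀ n, 0 ≤ b n) {ω : Linf →L[ℂ] ℂ}
    (hω : IsExtendedLimit ω) :
    (Real.log 2 : ℂ) * ω (dixSeq gW_isSlow (calD gW he x)) = ω (logMean x) := by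
  have hl2 : (Real.log 2 : ℂ) ≠ 0 := by exact_mod_cast (Real.log_pos one_lt_two).ne'
  rw [dixmier_calD gW_isSlow he hH hxb hb hω (y := (Real.log 2 : ℂ)⁻¹ • logMean x), map_smul,
    smul_eq_mul, mul_inv_cancel_left₀ hl2]
  -- The block j = 0 has weight g(1) = 1/2 and is the only one absent from `logSum`; it is a bounded
  -- error.
  have h := gW_isSlow.tendsto_div_primitive (a := fun _ => b 0 * (1 / 2)) (C := |b 0 * (1 / 2)|)
    fun _ _ => le_rfl
  refine h.congr fun n => ?_
  rw [lp.coeFn_smul, Pi.smul_apply, logMean_apply, smul_eq_mul, Finset.sum_range_succ']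
  have h0 : (2 : ℝ) ^ 0 * gW (2 ^ 0) = 1 / 2 := by
    rw [pow_zero, one_mul, gW_apply_of_lt one_lt_two]
  have h1 : logSum x (Nat.log 2 n) =
      ((∑ j ∈ Finset.range (Nat.log 2 n),
        b (j + 1) * (2 ^ (j + 1) * gW (2 ^ (j + 1))) : ℝ) : ℂ) := by
    rw [logSum, Complex.ofReal_sum]
    refine Finset.sum_congr rfl fun j _ => ?_
    rw [two_pow_mul_gW, hxb]
    push_cast
    ring
  rw [h0, h1, mul_div_assoc (Real.log 2 : ℂ), inv_mul_cancel_left₀ hl2]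
  push_cast
  ring

end LogMean

/-! ### The test sequence -/

section TestSequence

/-- The sequence `y` with real values. -/
noncomputable def yReal (k : ℕ) : ℝ := if Even (Nat.log 2 k) ∧ 2 ≤ Nat.log 2 k then 1 else 0

theorem yInf_apply (k : ℕ) : yInf k = yReal k := by
  have hiff : (∃ n : ℕ, 1 ≤ n ∧ 2 ^ (2 * n) ≤ k ∧ k < 2 ^ (2 * n + 1)) ↔
      Even (Nat.log 2 k) ∧ 2 ≤ Nat.log 2 k := by
    constructor
    · rintro ⟨n, hn, h1, h2⟩
      have hlog : Nat.log 2 k = 2 * n :=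
        (Nat.log_eq_iff (Or.inl (by omega))).mpr ⟨h1, h2⟩
      rw [hlog]
      exact ⟨even_two_mul n, by omega⟩
    · rintro ⟨⟨n, hn⟩, h2⟩
      have hk : k ≠ 0 := by rintro rfl; simp at h2
      obtain ⟨h3, h4⟩ := (Nat.log_eq_iff (b := 2) (m := 2 * n) (n := k)
        (Or.inl (by omega))).mp (by omega)
      exact ⟨n, by omega, h3, h4⟩
  change ySeq k = _
  simp only [ySeq, yReal]
  by_cases h : Even (Nat.log 2 k) ∧ 2 ≤ Nat.log 2 k
  · rw [if_pos (hiff.mpr h), if_pos h, Complex.ofReal_one]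
  · rw [if_neg (mt hiff.mp h), if_neg h, Complex.ofReal_zero]

theorem yReal_nonneg (k : ℕ) : 0 ≤ yReal k := by
  unfold yReal; split_ifs <;> norm_num

theorem yReal_le_one (k : ℕ) : yReal k ≤ 1 := by
  unfold yReal; split_ifs <;> norm_num

theorem yReal_of_lt {k : ℕ} (hk : k < 4) : yReal k = 0 := by
  have : Nat.log 2 k < 2 := Nat.log_lt_of_lt_pow' (by norm_num) (by simpa using hk)
  exact if_neg fun h => by omega

/-- Passing from k to 2k or 2k + 1 moves one dyadic block up and flips the parity. It fails for k =
1, since y vanishes on the blocks of both 1 and 2. -/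
theorem yReal_of_div_two {k l : ℕ} (hk : 2 ≤ k) (hl : l / 2 = k) : yReal l = 1 - yReal k := by
  have hlog : Nat.log 2 l = Nat.log 2 k + 1 := by
    rw [Nat.log_of_one_lt_of_le one_lt_two (by omega), hl]
  have h1 : 1 ≤ Nat.log 2 k := Nat.log_pos one_lt_two hk
  unfold yReal
  rw [hlog]
  simp only [Nat.even_add_one]
  by_cases he : Even (Nat.log 2 k)
  · have h2 : 2 ≤ Nat.log 2 k := by
      obtain ⟨r, hr⟩ := he; omega
    rw [if_neg (fun h => h.1 he), if_pos ⟨he, h2⟩, sub_self]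
  · rw [if_pos ⟨he, by omega⟩, if_neg (fun h => he h.1), sub_zero]

/-- The counting function of `y`. -/
noncomputable def yCount (m : ℕ) : ℝ := ∑ k ∈ Finset.range m, yReal k

theorem yCount_succ (m : ℕ) : yCount (m + 1) = yCount m + yReal m := Finset.sum_range_succ _ _

theorem yCount_of_le {m : ℕ} (hm : m ≤ 4) : yCount m = 0 :=
  Finset.sum_eq_zero fun k hk => yReal_of_lt (by have := Finset.mem_range.mp hk; omega)

/-- Each k ≥ 2 is replaced by two indices with the opposite value of y; the -4 removes the
contributions of k = 0 and k = 1. -/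
theorem yCount_two_mul {m : ℕ} (hm : 2 ≤ m) : yCount (2 * m) = 2 * (m - yCount m) - 4 := by
  induction m, hm using Nat.le_induction with
  | base => rw [yCount_of_le (by norm_num), yCount_of_le (by norm_num)]; norm_num
  | succ m hm ih =>
    have h1 : yReal (2 * m) = 1 - yReal m := yReal_of_div_two hm (by omega)
    have h2 : yReal (2 * m + 1) = 1 - yReal m := yReal_of_div_two hm (by omega)
    rw [show 2 * (m + 1) = 2 * m + 1 + 1 by ring, yCount_succ, yCount_succ, yCount_succ, ih, h1, h2]
    push_cast
    ring

/-- The recursion c ↦ 2(m - c) - 4 exchanges the two bounds at m with those at 2m exactly. At an odd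
argument 2k + 1 the count is the mean of its values at 2k and 2k + 2. -/
theorem yCount_bounds_of_two_le {m : ℕ} (hm : 2 ≤ m) :
    ((m : ℝ) - 4) / 3 ≤ yCount m ∧ yCount m ≤ (2 * (m : ℝ) - 4) / 3 := by
  induction m using Nat.strong_induction_on with
  | _ m ih =>
    rcases lt_or_ge m 4 with h4 | h4
    · rw [yCount_of_le h4.le]
      have h2' : (2 : ℝ) ≤ m := by exact_mod_cast hm
      have h4' : (m : ℝ) ≤ 4 := by exact_mod_cast h4.le
      constructor <;> linarith
    · obtain ⟨k, rfl | rfl⟩ := Nat.even_or_odd' m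
      · obtain ⟨h1, h2⟩ := ih k (by omega) (by omega)
        rw [yCount_two_mul (by omega)]
        push_cast
        constructor <;> linarith
      · obtain ⟨h1, h2⟩ := ih k (by omega) (by omega)
        obtain ⟨h3, h4⟩ := ih (k + 1) (by omega) (by omega)
        have hy : yReal (2 * k) = 1 - yReal k := yReal_of_div_two (by omega) (by omega)
        rw [yCount_succ] at h3 h4
        rw [yCount_succ, yCount_two_mul (by omega), hy]
        push_cast at h3 h4 ⊢
        constructor <;> linarith

theorem yCount_ge (m : ℕ) : ((m : ℝ) - 4) / 3 ≤ yCount m := by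
  rcases lt_or_ge m 2 with h | h
  · rw [yCount_of_le (by omega)]
    have : (m : ℝ) ≤ 2 := by exact_mod_cast h.le
    linarith
  · exact (yCount_bounds_of_two_le h).1

theorem yCount_le (m : ℕ) : yCount m ≤ 2 * (m : ℝ) / 3 := by
  rcases lt_or_ge m 2 with h | h
  · rw [yCount_of_le (by omega)]
    positivity
  · linarith [(yCount_bounds_of_two_le h).2]

/-- The counts at the end of a block of zeros and of a block of ones, where the Cesàro means
approach 1/3 and 2/3. -/
theorem yCount_four_pow (n : ℕ) : yCount (4 ^ (n + 1)) = (4 ^ (n + 1) - 4) / 3 ∧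
    yCount (2 * 4 ^ (n + 1)) = (4 * 4 ^ (n + 1) - 4) / 3 := by
  have hge : ∀ n : ℕ, 2 ≤ 4 ^ (n + 1) := fun n => by
    have := Nat.one_le_pow n 4 (by norm_num)
    rw [pow_succ]; omega
  have key : yCount (4 ^ (n + 1)) = (4 ^ (n + 1) - 4) / 3 := by
    induction n with
    | zero => rw [yCount_of_le (by norm_num)]; norm_num
    | succ n ih =>
      rw [show 4 ^ (n + 1 + 1) = 2 * (2 * 4 ^ (n + 1)) by ring,
        yCount_two_mul (by have := hge n; omega), yCount_two_mul (hge n), ih]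
      push_cast
      ring
  refine ⟨key, ?_⟩
  rw [yCount_two_mul (hge n), key]
  push_cast
  ring

/-- The centred logarithmic sums of `y` are bounded. -/
theorem exists_abs_sum_centred_le :
    ∃ K : ℝ, ∀ m, |∑ j ∈ Finset.range m, (yReal (j + 1) - 1 / 2) / ((j : ℝ) + 1)| ≤ K := by
  let L : ℕ → ℝ := fun m => ∑ j ∈ Finset.range m, (yReal (j + 1) - 1 / 2) / ((j : ℝ) + 1)
  have hL : ∀ m, L (m + 1) = L m + (yReal (m + 1) - 1 / 2) / ((m : ℝ) + 1) :=
    fun m => Finset.sum_range_succ _ _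
  have hw : ∀ k, |yReal k - 1 / 2| ≤ 1 / 2 := fun k => by
    have h1 := yReal_nonneg k
    have h2 := yReal_le_one k
    rw [abs_le]
    constructor <;> linarith
  -- The terms 2M + 2 and 2M + 3 of L have the sign opposite to the term M + 1 and almost cancel it;
  -- the remainder is bounded by a telescoping difference, hence the - 1/(M+1). Together with the
  -- bound on L(2M+1) - L(M) this bounds L(M).
  have hD : ∀ M, 1 ≤ M →
      |L (2 * M + 1) + L M| ≤ |L (2 * 1 + 1) + L 1| + 1 - 1 / ((M : ℝ) + 1) := by
    intro M hM
    induction M, hM using Nat.le_induction with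
    | base => push_cast; linarith
    | succ M hM ih =>
      have e1 : yReal (2 * M + 1 + 1) = 1 - yReal (M + 1) :=
        yReal_of_div_two (by omega) (by omega)
      have e2 : yReal (2 * M + 1 + 1 + 1) = 1 - yReal (M + 1) :=
        yReal_of_div_two (by omega) (by omega)
      have h1 : L (2 * (M + 1) + 1) + L (M + 1) = (L (2 * M + 1) + L M) +
          (yReal (M + 1) - 1 / 2) * (1 / ((2 * M + 2) * (2 * M + 3))) := by
        rw [show 2 * (M + 1) + 1 = 2 * M + 1 + 1 + 1 by ring, hL (2 * M + 1 + 1),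
          hL (2 * M + 1), hL M, e1, e2]
        push_cast
        field_simp
        ring
      have hpos : (0 : ℝ) < 1 / ((2 * M + 2) * (2 * M + 3)) := by positivity
      have h2 : |(yReal (M + 1) - 1 / 2) * (1 / ((2 * (M : ℝ) + 2) * (2 * M + 3)))| ≤
          1 / ((M : ℝ) + 1) - 1 / ((M : ℝ) + 1 + 1) := by
        rw [abs_mul, abs_of_pos hpos]
        calc _ ≤ 1 / 2 * (1 / ((2 * (M : ℝ) + 2) * (2 * M + 3))) :=
              mul_le_mul_of_nonneg_right (hw _) hpos.le
          _ ≤ 1 / (((M : ℝ) + 1) * (M + 1 + 1)) := by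
              rw [one_div_mul_one_div]
              apply one_div_le_one_div_of_le (by positivity)
              nlinarith [M.cast_nonneg (α := ℝ)]
          _ = _ := by field_simp; ring
      rw [h1]
      refine (abs_add_le _ _).trans ?_
      push_cast
      linarith
  have hdiff : ∀ M, |L (2 * M + 1) - L M| ≤ 1 / 2 := by
    intro M
    have h1 : L (2 * M + 1) - L M = ∑ i ∈ Finset.range (M + 1),
        (yReal (M + i + 1) - 1 / 2) / (((M + i : ℕ) : ℝ) + 1) := by
      rw [show 2 * M + 1 = M + (M + 1) by ring]
      simp only [L]
      rw [Finset.sum_range_add, add_sub_cancel_left]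
    rw [h1]
    refine (Finset.abs_sum_le_sum_abs _ _).trans ?_
    calc _ ≤ ∑ i ∈ Finset.range (M + 1), (1 / 2) / ((M : ℝ) + 1) := by
          refine Finset.sum_le_sum fun i _ => ?_
          rw [abs_div, abs_of_pos (by positivity : (0 : ℝ) < ((M + i : ℕ) : ℝ) + 1)]
          refine div_le_div₀ (by norm_num) (hw _) (by positivity) ?_
          push_cast
          linarith [i.cast_nonneg (α := ℝ)]
      _ = 1 / 2 := by
          rw [Finset.sum_const, Finset.card_range, nsmul_eq_mul]
          push_cast
          field_simp
  refine ⟨|L (2 * 1 + 1) + L 1| + 1 + 1 / 2, fun m => ?_⟩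
  change |L m| ≤ _
  have h0 : 0 ≤ |L (2 * 1 + 1) + L 1| := abs_nonneg _
  rcases Nat.eq_zero_or_pos m with rfl | hm
  · simp only [L, Finset.range_zero, Finset.sum_empty, abs_zero]
    linarith
  · have h1 := abs_le.mp (hD m hm)
    have h2 := abs_le.mp (hdiff m)
    have h3 : 0 ≤ 1 / ((m : ℝ) + 1) := by positivity
    rw [abs_le]
    constructor <;> linarith

theorem logMean_yInf_tendsto : Tendsto (fun n => logMean yInf n) atTop (𝓝 (1 / 2)) := by
  obtain ⟨K, hK⟩ := exists_abs_sum_centred_le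
  have hl2 : 0 < Real.log 2 := Real.log_pos one_lt_two
  have h1 := gW_isSlow.tendsto_div_primitive (C := Real.log 2 * K)
    (a := fun n => Real.log 2 * ∑ j ∈ Finset.range (Nat.log 2 n),
      (yReal (j + 1) - 1 / 2) / ((j : ℝ) + 1)) fun n _ => by
      rw [abs_mul, abs_of_pos hl2]
      exact mul_le_mul_of_nonneg_left (hK _) hl2.le
  have h := h1.add (tendsto_log_two_mul_harm.const_mul (1 / 2))
  rw [zero_add, mul_one] at h
  refine h.congr fun n => ?_
  have hs : logSum yInf (Nat.log 2 n) = ((∑ j ∈ Finset.range (Nat.log 2 n),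
      (yReal (j + 1) - 1 / 2) / ((j : ℝ) + 1) + 1 / 2 * harm (Nat.log 2 n) : ℝ) : ℂ) := by
    rw [logSum, harm, Finset.mul_sum, ← Finset.sum_add_distrib, Complex.ofReal_sum]
    refine Finset.sum_congr rfl fun j _ => ?_
    rw [yInf_apply]
    push_cast
    ring
  rw [logMean_apply, hs]
  push_cast
  ring

end TestSequence

/-! ### The transferred extended limit -/

section Transfer

variable {H : Type*} [NormedAddCommGroup H] [InnerProductSpace ℂ H] [CompleteSpace H]

theorem mu_antitoneOn (X : H →L[ℂ] H) : AntitoneOn (fun s => mu s X) (Ici 0) :=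
  fun _ hs _ _ hst => mu_anti hs hst X

/-- μ is a step function, constant on each [k, k+1). -/
theorem integral_mu (X : H →L[ℂ] H) {m n : ℕ} (hmn : m ≤ n) :
    ∫ s in (m : ℝ)..n, mu s X = sumMu n X - sumMu m X := by
  rw [← intervalIntegral.sum_integral_adjacent_intervals_Ico (a := fun k : ℕ => (k : ℝ)) hmn
    fun k _ => (mu_antitoneOn X).intervalIntegrable_of_nonneg (by positivity) (by positivity),
    sumMu, sumMu, ← Finset.sum_Ico_eq_sub _ hmn]
  refine Finset.sum_congr rfl fun k _ => ?_
  rw [intervalIntegral.integral_congr_Ioo_of_le (g := fun _ => mu k X) (by push_cast; linarith)]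
  · simp
  · intro s hs
    have hs0 : (0 : ℝ) ≤ s := (k.cast_nonneg).trans hs.1.le
    have hfl : ⌊s⌋₊ = k := (Nat.floor_eq_iff hs0).mpr ⟨hs.1.le, by simpa using hs.2⟩
    change mu s X = mu k X
    rw [mu_eq_mu_floor hs0, hfl]

theorem Phi_fW_apply (X : LIdeal H fW) (j : ℕ) : Phi fW X j =
    ((sumMu (2 ^ (j + 1)) (X : H →L[ℂ] H) - sumMu (2 ^ j) (X : H →L[ℂ] H) : ℝ) : ℂ) := by
  have h := integral_mu (X : H →L[ℂ] H) (Nat.pow_le_pow_right two_pos j.le_succ)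
  push_cast at h
  change ((1 / (2 ^ j * fW (2 ^ j)) *
    ∫ s in (2 ^ j : ℝ)..2 ^ (j + 1), mu s (X : H →L[ℂ] H) : ℝ) : ℂ) = _
  rw [two_pow_mul_fW, div_one, one_mul, h]

/-- Logarithmic averaging along the powers of two turns an extended limit into an extended
limit. -/
noncomputable def transferLimit (ω : Linf →L[ℂ] ℂ) : Linf →L[ℂ] ℂ :=
  ω ∘L logMean ∘L linfComp fun j => 2 ^ j

theorem logMean_nonneg {x : Linf} (hx : ∀ n, 0 ≤ x n) (n : ℕ) : 0 ≤ logMean x n := by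
  rw [logMean_apply, div_eq_mul_inv, ← Complex.ofReal_inv]
  have h1 : (0 : ℂ) ≤ ((gW.primitive n)⁻¹ : ℝ) := by
    exact_mod_cast inv_nonneg.mpr (gW_primitive_nonneg n)
  have h2 : (0 : ℂ) ≤ (Real.log 2 : ℝ) := by exact_mod_cast (Real.log_pos one_lt_two).le
  refine mul_nonneg (mul_nonneg h2 (Finset.sum_nonneg fun j _ => ?_)) h1
  rw [div_eq_mul_inv]
  have h3 : ((j : ℂ) + 1)⁻¹ = ((((j : ℝ) + 1)⁻¹ : ℝ) : ℂ) := by push_cast; rfl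
  rw [h3]
  have h4 : (0 : ℝ) ≤ ((j : ℝ) + 1)⁻¹ := by positivity
  exact mul_nonneg (hx _) (Complex.zero_le_real.mpr h4)

theorem transferLimit_isExtendedLimit {ω : Linf →L[ℂ] ℂ} (hω : IsExtendedLimit ω) :
    IsExtendedLimit (transferLimit ω) :=
  ⟨fun _ hx => hω.nonneg _ (logMean_nonneg fun j => hx (2 ^ j)), fun _ a ha =>
    hω.eq_lim _ a (logMean_tendsto (ha.comp (tendsto_pow_atTop_atTop_of_one_lt one_lt_two)))⟩

/-- Since F(2^j) = 1 + j log 2, the rescaled Dixmier averages of X along powers of two are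
asymptotic to the Cesàro means A(j+1)/(j+1) of x, and Abel summation applies. It serves both x =
Φ_f(X), with A(j) = S(2^j, X), and x = y, with A the counting function. -/
theorem transferLimit_dixSeq {ω : Linf →L[ℂ] ℂ} (hω : IsExtendedLimit ω) (X : LIdeal H fW)
    {x : Linf} {A : ℕ → ℝ} {C : ℝ} (hA : ∀ j, x j = ((A (j + 1) - A j : ℝ) : ℂ))
    (hC : ∀ j, |sumMu (2 ^ j + 1) (X : H →L[ℂ] H) - A (j + 1)| ≤ C) :
    (Real.log 2 : ℂ) * transferLimit ω (dixSeq fW_isSlow X) = ω (logMean x) := by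
  have hl2 : 0 < Real.log 2 := Real.log_pos one_lt_two
  have hl2' : Real.log 2 ≤ 1 := by
    have := Real.log_le_sub_one_of_pos (zero_lt_two (α := ℝ)); linarith
  rw [← smul_eq_mul, ← map_smul]
  change ω (logMean (linfComp (fun j => 2 ^ j) ((Real.log 2 : ℂ) • dixSeq fW_isSlow X))) = _
  symm
  apply hω.congr
  refine logMean_sub_tendsto_zero (A := fun j => (A j : ℂ)) (fun j => by
    rw [hA]; push_cast; rfl) ?_
  have hF : ∀ j : ℕ, fW.primitive (2 ^ j) = 1 + j * Real.log 2 := by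
    intro j
    rw [fW_primitive Nat.one_le_two_pow]
    push_cast
    rw [Real.log_pow]
  have hAn : ∀ n : ℕ, |A n| ≤ |A 0| + n * ‖x‖ := by
    intro n
    induction n with
    | zero => simp
    | succ n ih =>
      have h1 : |A (n + 1) - A n| ≤ ‖x‖ := by
        have := x.norm_apply_le n
        rwa [hA, Complex.norm_real] at this
      have h2 := abs_add_le (A (n + 1) - A n) (A n)
      rw [sub_add_cancel] at h2
      push_cast
      linarith
  have hT := ((fW_isSlow.tendsto.comp
    (tendsto_pow_atTop_atTop_of_one_lt (one_lt_two (α := ℕ)))).const_div_atTop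
      (C + (|A 0| + ‖x‖)))
  rw [tendsto_zero_iff_norm_tendsto_zero]
  refine squeeze_zero (fun _ => norm_nonneg _) (fun j => ?_) hT
  rw [linfComp_apply, lp.coeFn_smul, Pi.smul_apply, dixSeq_apply, smul_eq_mul]
  simp only [Function.comp_apply]
  rw [hF]
  set S := sumMu (2 ^ j + 1) (X : H →L[ℂ] H) with hS
  have hj : (0 : ℝ) < (j : ℝ) + 1 := by positivity
  have hFp : 0 < 1 + j * Real.log 2 := by positivity
  -- The denominators (j+1) log 2 and 1 + j log 2 differ by 1 - log 2, which produces the second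
  -- term of the numerator.
  have e : (A (j + 1) : ℂ) / ((j : ℂ) + 1) -
      (Real.log 2 : ℂ) * ((S / (1 + j * Real.log 2) : ℝ) : ℂ) =
      (((-(Real.log 2 * (S - A (j + 1))) + A (j + 1) / (j + 1) * (1 - Real.log 2)) /
        (1 + j * Real.log 2) : ℝ) : ℂ) := by
    have e' : A (j + 1) / ((j : ℝ) + 1) - Real.log 2 * (S / (1 + j * Real.log 2)) =
      (-(Real.log 2 * (S - A (j + 1))) + A (j + 1) / (j + 1) * (1 - Real.log 2)) /
        (1 + j * Real.log 2) := by
      field_simp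
      ring
    rw [← e']
    push_cast
    rfl
  rw [e, Complex.norm_real, Real.norm_eq_abs, abs_div, abs_of_pos hFp]
  refine div_le_div_of_nonneg_right ?_ hFp.le
  have hAj : |A (j + 1) / (j + 1)| ≤ |A 0| + ‖x‖ := by
    rw [abs_div, abs_of_pos hj, div_le_iff₀ hj]
    have h := hAn (j + 1)
    push_cast at h
    nlinarith [mul_nonneg (j.cast_nonneg (α := ℝ)) (abs_nonneg (A 0))]
  refine (abs_add_le _ _).trans (add_le_add ?_ ?_)
  · rw [abs_neg, abs_mul, abs_of_pos hl2]
    exact (mul_le_of_le_one_left (abs_nonneg _) hl2').trans (hC j)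
  · rw [abs_mul, abs_of_nonneg (sub_nonneg.mpr hl2')]
    exact (mul_le_of_le_one_right (abs_nonneg _) (by linarith)).trans hAj

/-- The composition of a Dixmier functional on `L_g(H)` with `𝒟_g ∘ Φ_f` is the Dixmier functional
of the transferred extended limit. -/
theorem dixmier_calD_Phi {e : ℕ → H} (he : Orthonormal ℂ e) (hH : ¬ FiniteDimensional ℂ H)
    {φ : LIdeal H gW →ₗ[ℂ] ℂ} {ω : Linf →L[ℂ] ℂ} (hω : IsExtendedLimit ω)
    (hφ : ∀ X : LIdeal H gW, (X : H →L[ℂ] H).IsPositive →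
      φ X = (Real.log 2 : ℂ) * ω (dixSeq gW_isSlow X)) (X : LIdeal H fW) :
    φ (calD gW he (Phi fW X)) =
      (Real.log 2 : ℂ) * transferLimit ω (dixSeq fW_isSlow X) := by
  have hx : ∀ j, 0 ≤ sumMu (2 ^ (j + 1)) (X : H →L[ℂ] H) - sumMu (2 ^ j) (X : H →L[ℂ] H) :=
    fun j => sub_nonneg.mpr (sumMu_mono (Nat.pow_le_pow_right two_pos j.le_succ) _)
  rw [hφ _ (sumMu_calD_sub_le gW_isSlow he hH (Phi_fW_apply X) hx).1,
    dixmier_calD_gW he hH (Phi_fW_apply X) hx hω]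
  -- S(2^j + 1) lies between S(2^j) and S(2^(j+1)), whose gap is the j-th entry of Φ_f(X).
  refine (transferLimit_dixSeq hω X (A := fun j => sumMu (2 ^ j) (X : H →L[ℂ] H))
    (C := ‖Phi fW X‖) (Phi_fW_apply X) fun j => ?_).symm
  have h1 : sumMu (2 ^ j) (X : H →L[ℂ] H) ≤ sumMu (2 ^ j + 1) (X : H →L[ℂ] H) :=
    sumMu_mono (Nat.le_succ _) _
  have h2 : sumMu (2 ^ j + 1) (X : H →L[ℂ] H) ≤ sumMu (2 ^ (j + 1)) (X : H →L[ℂ] H) := by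
    apply sumMu_mono
    have := Nat.one_le_two_pow (n := j)
    rw [pow_succ]; omega
  have h3 := (Phi fW X).norm_apply_le j
  rw [Phi_fW_apply, Complex.norm_real, Real.norm_of_nonneg (hx j)] at h3
  rw [abs_le]
  constructor <;> linarith

theorem transferLimit_calD_yInf {e : ℕ → H} (he : Orthonormal ℂ e) (hH : ¬ FiniteDimensional ℂ H)
    {ω : Linf →L[ℂ] ℂ} (hω : IsExtendedLimit ω) :
    (Real.log 2 : ℂ) * transferLimit ω (dixSeq fW_isSlow (calD fW he yInf)) = 1 / 2 := by
  obtain ⟨-, C, hC⟩ := sumMu_calD_sub_le fW_isSlow he hH yInf_apply yReal_nonneg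
  rw [transferLimit_dixSeq hω (calD fW he yInf) (x := yInf) (A := yCount) (C := C)]
  · exact hω.eq_lim _ _ logMean_yInf_tendsto
  · intro j
    rw [yCount_succ, add_sub_cancel_left, yInf_apply]
  · intro j
    have h := hC (2 ^ j) Nat.one_le_two_pow
    rw [Nat.log_pow one_lt_two] at h
    simp only [two_pow_mul_fW, mul_one] at h
    exact h

/-! ### Dixmier traces of `𝒟_f y` -/

/-- The Cesàro means of `y` along `⌊log₂ n⌋`. -/
noncomputable def yMean (n : ℕ) : ℝ := yCount (Nat.log 2 n + 1) / ((Nat.log 2 n : ℝ) + 1)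

theorem yMean_le (n : ℕ) : yMean n ≤ 2 / 3 := by
  rw [yMean, div_le_iff₀ (by positivity)]
  have := yCount_le (Nat.log 2 n + 1)
  push_cast at this
  linarith

theorem yMean_ge (n : ℕ) : 1 / 3 - 4 / 3 * (1 / ((Nat.log 2 n : ℝ) + 1)) ≤ yMean n := by
  have hp : (0 : ℝ) < (Nat.log 2 n : ℝ) + 1 := by positivity
  rw [yMean, le_div_iff₀ hp, sub_mul, mul_assoc, one_div_mul_cancel hp.ne']
  have := yCount_ge (Nat.log 2 n + 1)
  push_cast at this
  linarith

theorem yMean_nonneg (n : ℕ) : 0 ≤ yMean n :=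
  div_nonneg (Finset.sum_nonneg fun _ _ => yReal_nonneg _) (by positivity)

/-- The Cesàro means of `y` as an element of `ℓ_∞`. -/
noncomputable def yMeanInf : Linf := mkLinf (fun n => (yMean n : ℂ)) (2 / 3) fun n => by
  rw [Complex.norm_real, Real.norm_of_nonneg (yMean_nonneg n)]
  exact yMean_le n

/-- As 2^j f(2^j) = 1, the sums for 𝒟_f y are the counts of y, and (⌊log₂ n⌋ + 1) log 2 differs from
F(n) by a bounded amount. -/
theorem dixmier_calD_yInf {e : ℕ → H} (he : Orthonormal ℂ e) (hH : ¬ FiniteDimensional ℂ H)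
    {ω : Linf →L[ℂ] ℂ} (hω : IsExtendedLimit ω) :
    (Real.log 2 : ℂ) * ω (dixSeq fW_isSlow (calD fW he yInf)) = ω yMeanInf := by
  have hl2 : 0 < Real.log 2 := Real.log_pos one_lt_two
  have hl2' : Real.log 2 ≤ 1 := by
    have := Real.log_le_sub_one_of_pos (zero_lt_two (α := ℝ)); linarith
  have hl2c : (Real.log 2 : ℂ) ≠ 0 := by exact_mod_cast hl2.ne'
  rw [dixmier_calD fW_isSlow he hH yInf_apply yReal_nonneg hω
    (y := (Real.log 2 : ℂ)⁻¹ • yMeanInf), map_smul, smul_eq_mul, mul_inv_cancel_left₀ hl2c]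
  have h := fW_isSlow.tendsto_div_primitive (C := (Real.log 2)⁻¹ * 2)
    (a := fun n => (Real.log 2)⁻¹ * (yMean n *
      (((Nat.log 2 n : ℝ) + 1) * Real.log 2 - fW.primitive n))) (by
    intro n hn
    have hn0 : (0 : ℝ) < n := by exact_mod_cast hn
    have h1 : (Nat.log 2 n : ℝ) * Real.log 2 ≤ Real.log n := by
      rw [← Real.log_pow]
      apply Real.log_le_log (by positivity)
      exact_mod_cast Nat.pow_log_le_self 2 (by omega)
    have h2 : Real.log n ≤ ((Nat.log 2 n : ℝ) + 1) * Real.log 2 := by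
      have h3 : Real.log n ≤ Real.log ((2 : ℝ) ^ (Nat.log 2 n + 1)) := by
        apply Real.log_le_log hn0
        exact_mod_cast (Nat.lt_pow_succ_log_self one_lt_two n).le
      rw [Real.log_pow] at h3
      exact_mod_cast h3
    rw [fW_primitive hn, abs_mul, abs_mul, abs_of_pos (inv_pos.mpr hl2),
      abs_of_nonneg (yMean_nonneg n)]
    refine mul_le_mul_of_nonneg_left ?_ (inv_pos.mpr hl2).le
    have h4 : |((Nat.log 2 n : ℝ) + 1) * Real.log 2 - (1 + Real.log n)| ≤ 2 := by
      rw [abs_le]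
      constructor <;> linarith
    have h5 := yMean_le n
    calc _ ≤ 1 * 2 := mul_le_mul (by linarith) h4 (abs_nonneg _) zero_le_one
      _ = 2 := one_mul 2)
  refine h.congr' ?_
  filter_upwards [eventually_ge_atTop 1] with n hn
  have hF : fW.primitive n ≠ 0 := ((fW.pos 1 one_pos).trans_le (fW_isSlow.primitive_ge hn)).ne'
  have hp : (Nat.log 2 n : ℝ) + 1 ≠ 0 := by positivity
  have hsum : ∑ j ∈ Finset.range (Nat.log 2 n + 1), yReal j * (2 ^ j * fW (2 ^ j)) =
      yMean n * ((Nat.log 2 n : ℝ) + 1) := by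
    rw [yMean, div_mul_cancel₀ _ hp, yCount]
    exact Finset.sum_congr rfl fun j _ => by rw [two_pow_mul_fW, mul_one]
  rw [lp.coeFn_smul, Pi.smul_apply, smul_eq_mul, hsum]
  change _ = _ - (Real.log 2 : ℂ)⁻¹ * (yMean n : ℂ)
  rw [← Complex.ofReal_inv, ← Complex.ofReal_mul, ← Complex.ofReal_sub]
  congr 1
  field_simp

theorem extendedLimit_yMeanInf {ω : Linf →L[ℂ] ℂ} (hω : IsExtendedLimit ω) :
    ω yMeanInf ∈ Complex.ofReal '' Icc (1 / 3 : ℝ) (2 / 3) := by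
  have hup : ω yMeanInf ≤ ((2 / 3 : ℝ) : ℂ) := by
    let c : Linf := mkLinf (fun _ => ((2 / 3 : ℝ) : ℂ)) ‖((2 / 3 : ℝ) : ℂ)‖ fun _ => le_rfl
    rw [← hω.eq_lim c ((2 / 3 : ℝ) : ℂ) tendsto_const_nhds]
    exact hω.mono fun n => Complex.real_le_real.mpr (yMean_le n)
  have hlow : ((1 / 3 : ℝ) : ℂ) ≤ ω yMeanInf := by
    have hp : ∀ n, 0 ≤ 1 / ((Nat.log 2 n : ℝ) + 1) ∧ 1 / ((Nat.log 2 n : ℝ) + 1) ≤ 1 := by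
      intro n
      refine ⟨by positivity, ?_⟩
      rw [div_le_one (by positivity)]
      linarith [(Nat.log 2 n).cast_nonneg (α := ℝ)]
    let c : Linf := mkLinf
      (fun n => ((1 / 3 - 4 / 3 * (1 / ((Nat.log 2 n : ℝ) + 1)) : ℝ) : ℂ)) 2 fun n => by
        obtain ⟨h1, h2⟩ := hp n
        rw [Complex.norm_real, Real.norm_eq_abs, abs_le]
        constructor <;> linarith
    have hc : Tendsto (fun n => c n) atTop (𝓝 ((1 / 3 : ℝ) : ℂ)) := by
      have h0 : Tendsto (fun n : ℕ => 1 / ((Nat.log 2 n : ℝ) + 1)) atTop (𝓝 0) :=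
        tendsto_one_div_add_atTop_nhds_zero_nat.comp tendsto_natLog_two
      have h1 := (h0.const_mul (4 / 3)).const_sub (1 / 3)
      rw [mul_zero, sub_zero] at h1
      exact (Complex.continuous_ofReal.tendsto _).comp h1
    rw [← hω.eq_lim c _ hc]
    exact hω.mono fun n => Complex.real_le_real.mpr (yMean_ge n)
  -- In the order of ℂ, being comparable with a real number includes having imaginary part 0.
  rw [Complex.le_def] at hup hlow
  exact ⟨(ω yMeanInf).re, ⟨hlow.1, hup.1⟩, Complex.ext rfl hup.2.symm⟩

theorem tendsto_two_pow_sub_one {k : ℕ → ℕ} (hk : ∀ n, n < k n) :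
    Tendsto (fun n => 2 ^ (k n - 1)) atTop atTop :=
  tendsto_atTop_mono (fun n => (by have := hk n; omega : n ≤ k n - 1).trans Nat.lt_two_pow_self.le)
    tendsto_id

theorem yMean_two_pow {k : ℕ} (hk : 1 ≤ k) : yMean (2 ^ (k - 1)) = yCount k / k := by
  have h : k - 1 + 1 = k := by omega
  have h' : ((k - 1 : ℕ) : ℝ) + 1 = k := by exact_mod_cast h
  rw [yMean, Nat.log_pow one_lt_two, h, h']

/-- An extended limit is composed with sampling at n ↦ 2^(k n - 1), where the mean is exactly
yCount(k n)/k n. -/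
theorem exists_extendedLimit_of_subsequence {k : ℕ → ℕ} (hk : ∀ n, n < k n) {a : ℝ}
    (ha : Tendsto (fun n => yCount (k n) / (k n : ℝ)) atTop (𝓝 a)) :
    ∃ ω : Linf →L[ℂ] ℂ, IsExtendedLimit ω ∧ ω yMeanInf = a := by
  obtain ⟨ω, hω⟩ := exists_isExtendedLimit
  refine ⟨_, hω.comp_linfComp (tendsto_two_pow_sub_one hk), hω.eq_lim _ _ ?_⟩
  refine ((Complex.continuous_ofReal.tendsto a).comp ha).congr fun n => ?_
  change ((yCount (k n) / (k n : ℝ) : ℝ) : ℂ) = (yMean (2 ^ (k n - 1)) : ℂ)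
  rw [yMean_two_pow (by have := hk n; omega)]

theorem exists_extendedLimit_yMeanInf {r : ℝ} (hr : r ∈ Icc (1 / 3 : ℝ) (2 / 3)) :
    ∃ ω : Linf →L[ℂ] ℂ, IsExtendedLimit ω ∧ ω yMeanInf = r := by
  have hlt : ∀ n : ℕ, n < 4 ^ (n + 1) := fun n =>
    (Nat.lt_pow_self (by norm_num)).trans (Nat.pow_lt_pow_right (by norm_num) n.lt_succ_self)
  have h4 : Tendsto (fun n : ℕ => (1 / 4 : ℝ) ^ n) atTop (𝓝 0) :=
    tendsto_pow_atTop_nhds_zero_of_lt_one (by norm_num) (by norm_num)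
  obtain ⟨ω₁, hω₁, h₁⟩ := exists_extendedLimit_of_subsequence hlt (a := 1 / 3) (by
    have h := (h4.mul_const (1 / 3)).const_sub (1 / 3)
    rw [zero_mul, sub_zero] at h
    refine h.congr fun n => ?_
    rw [(yCount_four_pow n).1, one_div_pow, pow_succ]
    push_cast
    have : (4 : ℝ) ^ n ≠ 0 := by positivity
    field_simp
    ring)
  obtain ⟨ω₂, hω₂, h₂⟩ := exists_extendedLimit_of_subsequence (k := fun n => 2 * 4 ^ (n + 1))
    (fun n => (hlt n).trans_le (by omega)) (a := 2 / 3) (by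
    have h := (h4.mul_const (1 / 6)).const_sub (2 / 3)
    rw [zero_mul, sub_zero] at h
    refine h.congr fun n => ?_
    rw [(yCount_four_pow n).2, one_div_pow]
    push_cast
    rw [pow_succ]
    have : (4 : ℝ) ^ n ≠ 0 := by positivity
    field_simp
    ring)
  -- The weights solve s/3 + 2t/3 = r with s + t = 1; they are nonnegative exactly on [1/3, 2/3].
  refine ⟨_, hω₁.convex_comb hω₂ (s := 2 - 3 * r) (t := 3 * r - 1) (by linarith [hr.2])
    (by linarith [hr.1]) (by ring), ?_⟩
  change ((2 - 3 * r : ℝ) : ℂ) * ω₁ yMeanInf + ((3 * r - 1 : ℝ) : ℂ) * ω₂ yMeanInf = r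
  rw [h₁, h₂]
  push_cast
  ring

/-! ### Existence of traces and the assertions of the theorem -/

theorem exists_isDixmierTrace {g : Weight} (hH : ¬ FiniteDimensional ℂ H) (hg : g.IsSlow) :
    ∃ φ : LIdeal H g →ₗ[ℂ] ℂ, IsDixmierTrace φ := by
  obtain ⟨ω, hω⟩ := exists_isExtendedLimit
  obtain ⟨φ, hφ⟩ := exists_dixmier_functional hH hg hω
  exact ⟨φ, (isDixmierTrace_iff hg φ).mpr ⟨ω, hω, hφ⟩⟩

theorem exists_isDixmierTrace_calD_yInf {e : ℕ → H} (he : Orthonormal ℂ e)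
    (hH : ¬ FiniteDimensional ℂ H) {r : ℝ} (hr : r ∈ Icc (1 / 3 : ℝ) (2 / 3)) :
    ∃ ψ : LIdeal H fW →ₗ[ℂ] ℂ, IsDixmierTrace ψ ∧ ψ (calD fW he yInf) = r := by
  obtain ⟨ω, hω, h⟩ := exists_extendedLimit_yMeanInf hr
  obtain ⟨ψ, hψ⟩ := exists_dixmier_functional hH fW_isSlow hω
  refine ⟨ψ, (isDixmierTrace_iff fW_isSlow ψ).mpr ⟨ω, hω, hψ⟩, ?_⟩
  rw [hψ _ (sumMu_calD_sub_le fW_isSlow he hH yInf_apply yReal_nonneg).1,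
    dixmier_calD_yInf he hH hω, h]

theorem transfer_calD_yInf {e : ℕ → H} (he : Orthonormal ℂ e) (hH : ¬ FiniteDimensional ℂ H)
    {φ : LIdeal H gW →ₗ[ℂ] ℂ} {ψ : LIdeal H fW →ₗ[ℂ] ℂ} (hφ : IsDixmierTrace φ)
    (h : IsTransfer he φ ψ) : ψ (calD fW he yInf) = 1 / 2 := by
  obtain ⟨ω, hω, hφω⟩ := (isDixmierTrace_iff gW_isSlow φ).mp hφ
  rw [h _ (sumMu_calD_sub_le fW_isSlow he hH yInf_apply yReal_nonneg).1,
    dixmier_calD_Phi he hH hω hφω, transferLimit_calD_yInf he hH hω]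

theorem isDixmierTrace_of_isTransfer {e : ℕ → H} (he : Orthonormal ℂ e)
    (hH : ¬ FiniteDimensional ℂ H) {φ : LIdeal H gW →ₗ[ℂ] ℂ} {ψ : LIdeal H fW →ₗ[ℂ] ℂ}
    (hφ : IsDixmierTrace φ) (h : IsTransfer he φ ψ) : IsDixmierTrace ψ := by
  obtain ⟨ω, hω, hφω⟩ := (isDixmierTrace_iff gW_isSlow φ).mp hφ
  exact (isDixmierTrace_iff fW_isSlow ψ).mpr ⟨_, transferLimit_isExtendedLimit hω,
    fun X hX => (h X hX).trans (dixmier_calD_Phi he hH hω hφω X)⟩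

/-- Φ_f is not additive, but its composition with φ and 𝒟_g is, on the positive cone, the Dixmier
functional of the transferred limit, hence linear. Uniqueness holds because positive operators span.
-/
theorem existsUnique_isTransfer {e : ℕ → H} (he : Orthonormal ℂ e)
    (hH : ¬ FiniteDimensional ℂ H) {φ : LIdeal H gW →ₗ[ℂ] ℂ} (hφ : IsDixmierTrace φ) :
    ∃! ψ : LIdeal H fW →ₗ[ℂ] ℂ, IsTransfer he φ ψ := by
  obtain ⟨ω, hω, hφω⟩ := (isDixmierTrace_iff gW_isSlow φ).mp hφ
  obtain ⟨ψ, hψ⟩ := exists_dixmier_functional hH fW_isSlow (transferLimit_isExtendedLimit hω)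
  refine ⟨ψ, fun X hX => (hψ X hX).trans (dixmier_calD_Phi he hH hω hφω X).symm, fun ψ' h' => ?_⟩
  exact linearMap_ext_of_isPositive fun X hX =>
    ((h' X hX).trans (dixmier_calD_Phi he hH hω hφω X)).trans (hψ X hX).symm

theorem mem_LIdeal_fW_iff (X : H →L[ℂ] H) :
    X ∈ LIdeal H fW ↔ ∃ C : ℝ, ∀ n : ℕ, mu n X ≤ C / (n + 1) := by
  constructor
  · intro hX
    obtain ⟨C, hC0, hC⟩ := LIdeal.exists_mu_le (⟨X, hX⟩ : LIdeal H fW)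
    have hm := mu_nonneg 0 X
    -- For n ≥ 1, (n+1) μ(n) ≤ 2n μ(n) ≤ 2C; the term μ(0) covers n = 0.
    refine ⟨2 * C + mu 0 X, fun n => ?_⟩
    rw [le_div_iff₀ (by positivity)]
    rcases Nat.eq_zero_or_pos n with rfl | hn
    · rw [Nat.cast_zero]
      linarith
    · have hn' : (1 : ℝ) ≤ n := by exact_mod_cast hn
      have h := hC n (by linarith)
      rw [fW_apply_of_le hn', mul_one_div, le_div_iff₀ (by linarith)] at h
      change mu n X * n ≤ C at h
      nlinarith [mu_nonneg n X]
  · rintro ⟨C, hC⟩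
    have hC0 : 0 ≤ C := by
      have := (mu_nonneg _ X).trans (hC 0)
      simpa using this
    refine ⟨C, fun t ht => ?_⟩
    rw [div_le_iff₀ (fW.pos t ht), mu_eq_mu_floor ht.le]
    refine (hC _).trans ?_
    rcases lt_or_ge t 1 with h | h
    · rw [fW_apply_of_lt h, mul_one]
      exact div_le_self hC0 (by linarith [(⌊t⌋₊).cast_nonneg (α := ℝ)])
    · rw [fW_apply_of_le h, mul_one_div]
      exact div_le_div_of_nonneg_left hC0 ht (Nat.lt_floor_add_one t).le

end Transfer

theorem theorem4p6 {H : Type*} [NormedAddCommGroup H] [InnerProductSpace ℂ H] [CompleteSpace H]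
    [TopologicalSpace.SeparableSpace H] (e : ℕ → H) (he : Orthonormal ℂ e) :
    -- `L_f(H)` is the weak trace class ideal
    (∀ X : H →L[ℂ] H, X ∈ LIdeal H fW ↔ ∃ C : ℝ, ∀ n : ℕ, mu n X ≤ C / (n + 1)) ∧
    -- `i_{g,f}(φ)` is well defined for every Dixmier trace `φ` on `L_g(H)`
    (∀ φ : LIdeal H gW →ₗ[ℂ] ℂ, IsDixmierTrace φ →
      ∃! ψ : LIdeal H fW →ₗ[ℂ] ℂ, IsTransfer he φ ψ) ∧
    -- and it is a Dixmier trace on `L_f(H)`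
    (∀ (φ : LIdeal H gW →ₗ[ℂ] ℂ) (ψ : LIdeal H fW →ₗ[ℂ] ℂ),
      IsDixmierTrace φ → IsTransfer he φ ψ → IsDixmierTrace ψ) ∧
    -- but not every Dixmier trace on `L_f(H)` is of this form
    (∃ ψ : LIdeal H fW →ₗ[ℂ] ℂ, IsDixmierTrace ψ ∧
      ∀ φ : LIdeal H gW →ₗ[ℂ] ℂ, IsDixmierTrace φ → ¬ IsTransfer he φ ψ) ∧
    -- values of the images, and of all Dixmier traces on `L_f(H)`, on `𝒟_f y`
    {z : ℂ | ∃ (φ : LIdeal H gW →ₗ[ℂ] ℂ) (ψ : LIdeal H fW →ₗ[ℂ] ℂ),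
      IsDixmierTrace φ ∧ IsTransfer he φ ψ ∧ ψ (calD fW he yInf) = z} = {1 / 2} ∧
    {z : ℂ | ∃ ψ : LIdeal H fW →ₗ[ℂ] ℂ, IsDixmierTrace ψ ∧ ψ (calD fW he yInf) = z} =
      Complex.ofReal '' Set.Icc (1 / 3 : ℝ) (2 / 3) := by
  have hH : ¬ FiniteDimensional ℂ H := fun _ =>
    not_finite_iff_infinite.mpr (inferInstanceAs (Infinite ℕ)) he.linearIndependent.finite
  refine ⟨mem_LIdeal_fW_iff, fun φ hφ => existsUnique_isTransfer he hH hφ,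
    fun φ ψ hφ h => isDixmierTrace_of_isTransfer he hH hφ h, ?_, ?_, ?_⟩
  -- Any value in [1/3, 2/3] other than 1/2 would do.
  · obtain ⟨ψ, hψ, hv⟩ := exists_isDixmierTrace_calD_yInf he hH (r := 1 / 3)
      ⟨le_rfl, by norm_num⟩
    refine ⟨ψ, hψ, fun φ hφ h => ?_⟩
    have h2 := transfer_calD_yInf he hH hφ h
    rw [hv] at h2
    norm_num at h2
  · ext z
    constructor
    · rintro ⟨φ, ψ, hφ, h, rfl⟩
      exact transfer_calD_yInf he hH hφ h
    · rintro rfl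
      obtain ⟨φ, hφ⟩ := exists_isDixmierTrace hH gW_isSlow
      obtain ⟨ψ, hψ, -⟩ := existsUnique_isTransfer he hH hφ
      exact ⟨φ, ψ, hφ, hψ, transfer_calD_yInf he hH hφ hψ⟩
  · ext z
    constructor
    · rintro ⟨ψ, hψ, rfl⟩
      obtain ⟨ω, hω, hψω⟩ := (isDixmierTrace_iff fW_isSlow ψ).mp hψ
      rw [hψω _ (sumMu_calD_sub_le fW_isSlow he hH yInf_apply yReal_nonneg).1,
        dixmier_calD_yInf he hH hω]
      exact extendedLimit_yMeanInf hω
    · rintro ⟨r, hr, rfl⟩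
      exact exists_isDixmierTrace_calD_yInf he hH hr
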